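/- Let $M$ be a connected Riemann surface with base point $o$. Let $\widetilde M$ be its universal covering, realized as the set of homotopy classes $[\gamma]$ (with fixed end points) of paths $\gamma$ in $M$ starting at $o$, with projection $\pi([\gamma])=\gamma(1)$; an element $\tau=[\gamma_1]\in\pi_1(M)=\pi_1(M,o)$ acts on $\widetilde M$ as the covering transformation $\tau([\gamma])=[\gamma_1*\gamma]$, where $\gamma_1*\gamma$ is $\gamma_1$ followed by $\gamma$. A reflection of $M$ is an orientation-reversing conformal involution $\mu\colon M\to M$. Let $\mu_1,\dots,\mu_N$ be reflections of $M$, and for each $j$ let $P_j\colon[0,1]\to M$ be a path from $o$ to $\mu_j(o)$ with $\mu_j(P_j(u))=P_j(1-u)$ for all $u$. Let $\tilde\mu_j([\gamma])=[P_j*(\mu_j\circ\gamma)]$ be the lift of $\mu_j$ to $\widetilde M$ with respect to $P_j$. Assume that $\{\tilde\mu_1,\dots,\tilde\mu_N\}$ is a generator of $\pi_1(M)$, that is, every covering transformation $\tau\in\pi_1(M)$ can be written as $\tau=\tilde\mu_{i_1}\circ\cdots\circ\tilde\mu_{i_{2r}}$ with an even number of factors. Let $G$ be a meromorphic function and $Q$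 a holomorphic $2$-differential on $M$ such that $(G,Q)$ is admissible: $dG\not\equiv0$ and $ds^2_\#=(1+|G|^2)^2\,|Q/dG|^2$ gives (after extension across the poles of $G$ and the zeros of $dG$) a positive definite Riemannian metric on $M$. Assume that $(G,Q)$ is $\mu_j$-invariant for each $j$: $\mu_j^*ds^2_\#=ds^2_\#$ and $\overline{\mu_j^*Q}=Q$. Let $F\colon\widetilde M\to \mathrm{SL}_2(\mathbb C)$ be a holomorphic solution of $$dF\,F^{-1}=\Psi,\qquad \Psi=\begin{pmatrix}\widetilde G&-\widetilde G^2\\1&-\widetilde G\end{pmatrix}\frac{\widetilde Q}{d\widetilde G},\qquad \widetilde G=G\circ\pi,\quad \widetilde Q=\pi^*Q .$$ A matrix $\rho\in\mathrm{SL}_2(\mathbb C)$ is called a reflection matrix $\rho(\tilde\mu_j)$ of $F$ if there is $\sigma\in\mathrm{SL}_2(\mathbb C)$ with $$\overline{G\circ\mu_j}=\sigma\star G\qquad\text{and}\qquad \overline{F\circ\tilde\mu_j}=\sigma F\rho^{-1},$$ where $\sigma\star G=\dfrac{\sigma_{11}G+\sigma_{12}}{\sigma_{21}G+\sigma_{22}}$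 denotes the Möbius transformation. Let $\mathrm{SU}_{1,1}=\{a\in\mathrm{SL}_2(\mathbb C): a\,e_3\,a^*=e_3\}$ with $e_3=\mathrm{diag}(1,-1)$. Suppose that, for every $j=1,\dots,N$, the reflection matrices $\rho(\tilde\mu_j)$ of $F$ lie in $\mathrm{SU}_{1,1}$. Then there is a unique representation $\rho_F\colon\pi_1(M)\to\mathrm{SL}_2(\mathbb C)$ with $$F\circ\tau=F\,\rho_F(\tau)^{-1}\qquad(\tau\in\pi_1(M)),$$ and its image $\rho_F(\pi_1(M))$ lies in $\mathrm{SU}_{1,1}$. -/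

import Mathlib

open scoped Manifold ContDiff Topology MatrixGroups ComplexConjugate
open Set Filter

noncomputable section

/-! ### The special unitary group of signature `(1,1)` -/

/-- `SU_{1,1} = {a ∈ SL₂(ℂ) : a e₃ a* = e₃}`, where `e₃ = diag(1, -1)`. -/
def SU11 : Subgroup SL(2, ℂ) where
  carrier := {a | (a : Matrix (Fin 2) (Fin 2) ℂ) * !![1, 0; 0, -1] *
    (a : Matrix (Fin 2) (Fin 2) ℂ).conjTranspose = !![1, 0; 0, -1]}
  one_mem' := by simp
  mul_mem' := by
    intro a b ha hb
    simp only [mem_ofPred_eq, Matrix.SpecialLinearGroup.coe_mul, Matrix.conjTranspose_mul] at *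
    calc _ = (a : Matrix (Fin 2) (Fin 2) ℂ) * ((b : Matrix (Fin 2) (Fin 2) ℂ) * !![1, 0; 0, -1] *
          (b : Matrix (Fin 2) (Fin 2) ℂ).conjTranspose) *
          (a : Matrix (Fin 2) (Fin 2) ℂ).conjTranspose := by simp only [Matrix.mul_assoc]
      _ = _ := by rw [hb, ha]
  inv_mem' := by
    intro a ha
    simp only [mem_ofPred_eq] at *
    have h1 : ((a⁻¹ : SL(2, ℂ)) : Matrix (Fin 2) (Fin 2) ℂ) * (a : Matrix (Fin 2) (Fin 2) ℂ) = 1 := by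
      rw [← Matrix.SpecialLinearGroup.coe_mul]; simp
    have h2 : (a : Matrix (Fin 2) (Fin 2) ℂ).conjTranspose *
        ((a⁻¹ : SL(2, ℂ)) : Matrix (Fin 2) (Fin 2) ℂ).conjTranspose = 1 := by
      rw [← Matrix.conjTranspose_mul, h1, Matrix.conjTranspose_one]
    calc _ = ((a⁻¹ : SL(2, ℂ)) : Matrix (Fin 2) (Fin 2) ℂ) *
          ((a : Matrix (Fin 2) (Fin 2) ℂ) * !![1, 0; 0, -1] *
            (a : Matrix (Fin 2) (Fin 2) ℂ).conjTranspose) *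
          ((a⁻¹ : SL(2, ℂ)) : Matrix (Fin 2) (Fin 2) ℂ).conjTranspose := by rw [ha]
      _ = (((a⁻¹ : SL(2, ℂ)) : Matrix (Fin 2) (Fin 2) ℂ) * (a : Matrix (Fin 2) (Fin 2) ℂ)) *
          !![1, 0; 0, -1] * ((a : Matrix (Fin 2) (Fin 2) ℂ).conjTranspose *
            ((a⁻¹ : SL(2, ℂ)) : Matrix (Fin 2) (Fin 2) ℂ).conjTranspose) := by
          simp only [Matrix.mul_assoc]
      _ = _ := by rw [h1, h2, Matrix.one_mul, Matrix.mul_one]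

/-! ### The universal covering as a space of homotopy classes of paths -/

section Cover

variable {M : Type*} [TopologicalSpace M]

/-- The universal covering of `M` with base point `o`: homotopy classes (with fixed end points)
`[γ]` of continuous paths `γ` in `M` that start at `o`. The covering projection is
`π : p = [γ] ↦ p.proj = γ(1)`. -/
structure UniversalCover (o : M) where
  proj : M
  cls : Path.Homotopic.Quotient o proj

/-- The sheet over `U` through `p = [γ]`: all `[γ * δ]`, where `δ` is a path inside `U` which
starts at the end point of `γ`. -/
def UniversalCover.sheet {o : M} (p : UniversalCover o) (U : Set M) : Set (UniversalCover o) :=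
  {q | ∃ δ : Path p.proj q.proj, (∀ t, δ t ∈ U) ∧ q.cls = p.cls.trans (Path.Homotopic.Quotient.mk δ)}

/-- The usual topology of the universal covering, generated by the sheets over open sets. For a
manifold `M`, it makes the projection a local homeomorphism. -/
instance (o : M) : TopologicalSpace (UniversalCover o) :=
  TopologicalSpace.generateFrom
    {S | ∃ (p : UniversalCover o) (U : Set M), IsOpen U ∧ p.proj ∈ U ∧ S = p.sheet U}

/-- The fundamental group of `M` at `o`, where the product of `[γ₁]` and `[γ₂]` is `[γ₁ * γ₂]`
(first `γ₁`, then `γ₂`). Mathlib's `FundamentalGroup` has the opposite multiplication. -/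
abbrev PiOne (o : M) : Type _ := (FundamentalGroup M o)ᵐᵒᵖ

/-- The covering transformation `[γ] ↦ [γ₁ * γ]` of `τ = [γ₁]`. -/
def coveringTransformation {o : M} (τ : PiOne o) (p : UniversalCover o) : UniversalCover o :=
  ⟨p.proj, (FundamentalGroup.toPath τ.unop).trans p.cls⟩

/-- The lift `[γ] ↦ [P * (μ ∘ γ)]` of `μ` with respect to the path `P` from `o` to `μ o`. -/
def reflectionLift {o : M} (μ : C(M, M)) (P : Path o (μ o)) (p : UniversalCover o) :
    UniversalCover o :=
  ⟨μ p.proj, (Path.Homotopic.Quotient.mk P).trans (p.cls.map μ)⟩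

/-- `P` is `μ`-invariant: `μ (P u) = P (1 - u)`. -/
def IsInvariantPath {o : M} (μ : C(M, M)) (P : Path o (μ o)) : Prop :=
  ∀ u, μ (P u) = P (unitInterval.symm u)

/-- Every covering transformation is a composition of an even number of the maps `m j`. -/
def IsGenerator {o : M} {N : ℕ} (m : Fin N → UniversalCover o → UniversalCover o) : Prop :=
  ∀ τ : PiOne o, ∃ l : List (Fin N), Even l.length ∧
    coveringTransformation τ = (l.map m).foldr (· ∘ ·) id

end Cover

/-! ### Functions, differentials and metrics on a Riemann surface

All objects are described in the local coordinates `φ ∈ atlas ℂ M`. -/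

section RiemannSurface

variable {M : Type*} [TopologicalSpace M] [ChartedSpace ℂ M]

/-- A reflection: a conformal, orientation-reversing (that is, antiholomorphic) involution. -/
structure IsReflection (μ : C(M, M)) : Prop where
  involutive : Function.Involutive μ
  antiholomorphic : ∀ φ ∈ atlas ℂ M, ∀ ψ ∈ atlas ℂ M, ∀ z ∈ φ.target, μ (φ.symm z) ∈ ψ.source →
    DifferentiableAt ℂ (fun w => conj (ψ (μ (φ.symm w)))) z

/-- The value of a finite point of the Riemann sphere `ℂ ∪ {∞}` (and `0` at `∞`). -/
def sphereVal (c : OnePoint ℂ) : ℂ := c.elim 0 id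

/-- The value of `1 / c` for a point `c ≠ 0` of the Riemann sphere (and `0` at `0`). -/
def sphereInvVal (c : OnePoint ℂ) : ℂ := c.elim 0 fun w => w⁻¹

/-- A meromorphic function on `M`: a holomorphic map to the Riemann sphere that is not identically
`∞`. Near a point where `G ≠ ∞` it is given by `G`, and near a point where `G ≠ 0` by `1 / G`. -/
structure IsMeromorphicFunction (G : M → OnePoint ℂ) : Prop where
  continuous : Continuous G
  holomorphic : ∀ φ ∈ atlas ℂ M, ∀ z ∈ φ.target, G (φ.symm z) ≠ OnePoint.infty →
    DifferentiableAt ℂ (fun w => sphereVal (G (φ.symm w))) z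
  holomorphic_inv : ∀ φ ∈ atlas ℂ M, ∀ z ∈ φ.target, G (φ.symm z) ≠ ((0 : ℂ) : OnePoint ℂ) →
    DifferentiableAt ℂ (fun w => sphereInvVal (G (φ.symm w))) z
  exists_finite : ∃ x, G x ≠ OnePoint.infty

/-- `dG / dz` in the coordinate `φ` at the coordinate value `z`, where `G` is finite. -/
def coordDeriv (G : M → OnePoint ℂ) (φ : OpenPartialHomeomorph M ℂ) (z : ℂ) : ℂ :=
  deriv (fun w => sphereVal (G (φ.symm w))) z

/-- The point with coordinate `z` is neither a pole of `G` nor a zero of `dG`. -/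
def IsRegularAt (G : M → OnePoint ℂ) (φ : OpenPartialHomeomorph M ℂ) (z : ℂ) : Prop :=
  G (φ.symm z) ≠ OnePoint.infty ∧ coordDeriv G φ z ≠ 0

variable (M) in
/-- A holomorphic `2`-differential, given by `coeff φ (z) dz²` in the coordinate `z = φ`. Only the
values of `coeff φ` on `φ.target` for `φ` in the atlas matter. -/
structure HolomorphicTwoDifferential where
  coeff : OpenPartialHomeomorph M ℂ → ℂ → ℂ
  holomorphic : ∀ φ ∈ atlas ℂ M, DifferentiableOn ℂ (coeff φ) φ.target
  transition : ∀ φ ∈ atlas ℂ M, ∀ ψ ∈ atlas ℂ M, ∀ z ∈ φ.target, φ.symm z ∈ ψ.source →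
    coeff φ z = coeff ψ (ψ (φ.symm z)) * deriv (fun w => ψ (φ.symm w)) z ^ 2

variable (M) in
/-- A Riemannian metric in the conformal class of `M`, given by `coeff φ (z) |dz|²` in the
coordinate `z = φ`, where `coeff φ` is smooth and positive. -/
structure ConformalMetric where
  coeff : OpenPartialHomeomorph M ℂ → ℂ → ℝ
  smooth : ∀ φ ∈ atlas ℂ M, ContDiffOn ℝ ∞ (coeff φ) φ.target
  pos : ∀ φ ∈ atlas ℂ M, ∀ z ∈ φ.target, 0 < coeff φ z
  transition : ∀ φ ∈ atlas ℂ M, ∀ ψ ∈ atlas ℂ M, ∀ z ∈ φ.target, φ.symm z ∈ ψ.source →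
    coeff φ z = coeff ψ (ψ (φ.symm z)) * ‖deriv (fun w => ψ (φ.symm w)) z‖ ^ 2

/-- `g` is the metric `ds² = (1 + |G|²)² |Q / dG|²`. At the poles of `G` and the zeros of `dG`,
where the expression is undefined, `ds²` is its continuous extension; it is determined by the
other points, which are dense if `G` is not constant. -/
def IsSharpMetric (G : M → OnePoint ℂ) (Q : HolomorphicTwoDifferential M)
    (g : ConformalMetric M) : Prop :=
  ∀ φ ∈ atlas ℂ M, ∀ z ∈ φ.target, IsRegularAt G φ z →
    g.coeff φ z =
      (1 + ‖sphereVal (G (φ.symm z))‖ ^ 2) ^ 2 * ‖Q.coeff φ z / coordDeriv G φ z‖ ^ 2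

/-- `(G, Q)` is admissible: `dG` is not identically zero (so that `Q / dG` makes sense), and
`(1 + |G|²)² |Q / dG|²` gives a positive definite Riemannian metric on all of `M`. -/
def IsAdmissible (G : M → OnePoint ℂ) (Q : HolomorphicTwoDifferential M) : Prop :=
  (∃ φ ∈ atlas ℂ M, ∃ z ∈ φ.target, IsRegularAt G φ z) ∧ ∃ g, IsSharpMetric G Q g

/-- `(G, Q)` is `μ`-invariant: the metric `ds²` equals its pull-back by `μ`, and `Q` equals the
complex conjugate of its pull-back by `μ`. -/
structure IsInvariantPair (μ : C(M, M)) (G : M → OnePoint ℂ) (Q : HolomorphicTwoDifferential M) :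
    Prop where
  metric : ∀ g, IsSharpMetric G Q g → ∀ φ ∈ atlas ℂ M, ∀ ψ ∈ atlas ℂ M, ∀ z ∈ φ.target,
    μ (φ.symm z) ∈ ψ.source →
      g.coeff ψ (ψ (μ (φ.symm z))) * ‖deriv (fun w => conj (ψ (μ (φ.symm w)))) z‖ ^ 2 =
        g.coeff φ z
  differential : ∀ φ ∈ atlas ℂ M, ∀ ψ ∈ atlas ℂ M, ∀ z ∈ φ.target, μ (φ.symm z) ∈ ψ.source →
    conj (Q.coeff ψ (ψ (μ (φ.symm z)))) * deriv (fun w => conj (ψ (μ (φ.symm w)))) z ^ 2 =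
      Q.coeff φ z

/-! ### The differential equation on the universal covering -/

variable {o : M}

/-- `D` is the complex derivative at `p` of the matrix-valued function `F` on the universal
covering with respect to the local coordinate `φ ∘ π` induced by the coordinate `φ` of `M`. -/
def HasCoordDerivAt (F : UniversalCover o → SL(2, ℂ)) (φ : OpenPartialHomeomorph M ℂ)
    (D : Matrix (Fin 2) (Fin 2) ℂ) (p : UniversalCover o) : Prop :=
  ∀ i j, Tendsto (fun q => (F q i j - F p i j) / (φ q.proj - φ p.proj)) (𝓝[≠] p) (𝓝 (D i j))

/-- The coefficient of `dz` in `Ψ = (G, -G²; 1, -G) Q / dG`, in the coordinate `z = φ`. -/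
def psiCoeff (G : M → OnePoint ℂ) (Q : HolomorphicTwoDifferential M)
    (φ : OpenPartialHomeomorph M ℂ) (z : ℂ) : Matrix (Fin 2) (Fin 2) ℂ :=
  (Q.coeff φ z / coordDeriv G φ z) •
    !![sphereVal (G (φ.symm z)), -sphereVal (G (φ.symm z)) ^ 2; 1, -sphereVal (G (φ.symm z))]

/-- `F` is a holomorphic solution of `dF F⁻¹ = Ψ` on the universal covering. As an identity of
holomorphic forms, the equation has to be tested at the points over which `Ψ` is given by its
formula (neither `G = ∞` nor `dG = 0`); they are dense for an admissible pair. -/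
def IsSolution (G : M → OnePoint ℂ) (Q : HolomorphicTwoDifferential M)
    (F : UniversalCover o → SL(2, ℂ)) : Prop :=
  ∀ p : UniversalCover o, ∀ φ ∈ atlas ℂ M, p.proj ∈ φ.source →
    ∃ D, HasCoordDerivAt F φ D p ∧ (IsRegularAt G φ (φ p.proj) →
      D * ((F p)⁻¹ : SL(2, ℂ)) = psiCoeff G Q φ (φ p.proj))

end RiemannSurface

/-! ### Monodromy and reflection matrices -/

section Matrices

variable {M : Type*} [TopologicalSpace M] {o : M}

/-- `ρ` is the representation associated to `F`: `F ∘ τ = F ρ(τ)⁻¹` for all `τ ∈ π₁(M)`. -/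
def IsAssociatedRepresentation (F : UniversalCover o → SL(2, ℂ)) (ρ : PiOne o →* SL(2, ℂ)) :
    Prop :=
  ∀ τ p, F (coveringTransformation τ p) = F p * (ρ τ)⁻¹

/-- `ρ` is a matrix `ρ(μ̃)` of the lift `μ̃` of the reflection `μ` with respect to `P`: there is
`σ ∈ SL₂(ℂ)` such that the complex conjugate of `G ∘ μ` is the Möbius transform `σ ⋆ G` and the
complex conjugate of `F ∘ μ̃` is `σ F ρ⁻¹`. -/
def IsReflectionMatrix (G : M → OnePoint ℂ) (F : UniversalCover o → SL(2, ℂ)) (μ : C(M, M))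
    (P : Path o (μ o)) (ρ : SL(2, ℂ)) : Prop :=
  ∃ σ : SL(2, ℂ), (∀ x, (G (μ x)).map conj = (σ : GL (Fin 2) ℂ) • G x) ∧
    ∀ p, Matrix.SpecialLinearGroup.map (starRingEnd ℂ) (F (reflectionLift μ P p)) =
      σ * F p * ρ⁻¹

end Matrices

end

noncomputable section

/-! ### Lifting small disks to the universal covering -/

section Lift

variable {M : Type*} [TopologicalSpace M] {o : M}

/-! The representation exists because `F` and `F ∘ τ` solve the same linear equation: if `F` and `H`
both satisfy `dH = Ψ H`, then `F⁻¹ H` has zero derivative where `Ψ` is given by its formula. Such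
points are dense, so continuity of the derivative makes `F⁻¹ H` constant (`SolvesOn.exists_eq_mul`).

For the image, the hypothesis on reflection matrices says something only once such matrices are
known to exist. Invariance of the metric and of `Q` shows that `G` and the conjugate of `G ∘ μ` pull
back the spherical metric to the same metric. Polarizing this identity and integrating it gives a
Möbius transformation `σ` between the two maps near one point (`exists_smul_eq_of_metric_eq`), hence
everywhere by the identity theorem. Since `Ψ` for `σ ⋆ G` is `σ Ψ σ⁻¹` (`psiCoeff_smul`),
multiplying the conjugate of `F ∘ μ̃` by `σ⁻¹` gives a solution of the equation of `F`. It therefore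
equals `F C` with `C` constant, and `C⁻¹` is a reflection matrix.

Composing an even number of lifts gives `F ∘ τ = A F B`, where `B ∈ SU11` and the same `A` describes
the effect on `G` (`exists_mul_mul_of_word`). A covering transformation does not change the
projection, so `G = A ⋆ G`. As `G` is not constant, `A = ±1`, and `ρ_F(τ)⁻¹ = ±B` lies in `SU11`. -/

theorem Path.Homotopic.Quotient.trans_assoc' {x y z w : M} (a : Path.Homotopic.Quotient x y)
    (b : Path.Homotopic.Quotient y z) (c : Path.Homotopic.Quotient z w) :
    (a.trans b).trans c = a.trans (b.trans c) := by
  induction a using Path.Homotopic.Quotient.ind with | mk a =>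
  induction b using Path.Homotopic.Quotient.ind with | mk b =>
  induction c using Path.Homotopic.Quotient.ind with | mk c =>
  simp only [← Path.Homotopic.Quotient.mk_trans]
  exact Path.Homotopic.Quotient.eq.2 ⟨Path.Homotopy.transAssoc a b c⟩

theorem Path.Homotopic.Quotient.trans_refl' {x y : M} (a : Path.Homotopic.Quotient x y) :
    a.trans (.mk (Path.refl y)) = a := by
  induction a using Path.Homotopic.Quotient.ind with | mk a =>
  simp only [← Path.Homotopic.Quotient.mk_trans]
  exact Path.Homotopic.Quotient.eq.2 ⟨Path.Homotopy.transRefl a⟩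

theorem Path.Homotopic.Quotient.map_trans' {N : Type*} [TopologicalSpace N] {x y z : M}
    (a : Path.Homotopic.Quotient x y) (b : Path.Homotopic.Quotient y z) (f : C(M, N)) :
    (a.trans b).map f = (a.map f).trans (b.map f) := by
  induction a using Path.Homotopic.Quotient.ind with | mk a =>
  induction b using Path.Homotopic.Quotient.ind with | mk b =>
  simp only [← Path.Homotopic.Quotient.mk_trans, ← Path.Homotopic.Quotient.mk_map, Path.map_trans]

/-- An open set that is path connected and simply connected, phrased through paths inside it. -/
structure IsDisk (U : Set M) : Prop where
  isOpen : IsOpen U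
  joinedIn : ∀ x ∈ U, ∀ y ∈ U, JoinedIn U x y
  homotopic : ∀ {x y : M} (γ δ : Path x y), (∀ t, γ t ∈ U) → (∀ t, δ t ∈ U) → γ.Homotopic δ

namespace UniversalCover

/-- The point `[γ * δ]` for `p = [γ]`. -/
def append (p : UniversalCover o) {y : M} (δ : Path p.proj y) : UniversalCover o :=
  ⟨y, p.cls.trans (.mk δ)⟩

theorem append_congr (p : UniversalCover o) {y : M} {δ δ' : Path p.proj y} (h : δ.Homotopic δ') :
    p.append δ = p.append δ' := by
  rw [append, append, Path.Homotopic.Quotient.eq.2 h]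

theorem append_append (p : UniversalCover o) {y z : M} (δ : Path p.proj y) (ε : Path y z) :
    (p.append δ).append (y := z) ε = p.append (δ.trans ε) := by
  simp only [append, Path.Homotopic.Quotient.trans_assoc', Path.Homotopic.Quotient.mk_trans]

theorem append_refl (p : UniversalCover o) : p.append (Path.refl p.proj) = p := by
  simp only [append, Path.Homotopic.Quotient.trans_refl']

theorem append_mem_sheet (p : UniversalCover o) {U : Set M} {y : M} (δ : Path p.proj y)
    (hδ : ∀ t, δ t ∈ U) : p.append δ ∈ p.sheet U :=
  ⟨δ, hδ, rfl⟩

theorem exists_eq_append {p q : UniversalCover o} {U : Set M} (h : q ∈ p.sheet U) :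
    ∃ δ : Path p.proj q.proj, (∀ t, δ t ∈ U) ∧ q = p.append δ := by
  obtain ⟨δ, hδ, hq⟩ := h
  refine ⟨δ, hδ, ?_⟩
  rw [append, ← hq]

open Classical in
/-- The point over `x` on the sheet over the disk `U` through `p`. -/
def lift (p : UniversalCover o) (U : Set M) (x : M) : UniversalCover o :=
  if h : JoinedIn U p.proj x then p.append h.somePath else p

theorem lift_eq_append {U : Set M} (hU : IsDisk U) (p : UniversalCover o) {x : M}
    (δ : Path p.proj x) (hδ : ∀ t, δ t ∈ U) : p.lift U x = p.append δ := by
  have h : JoinedIn U p.proj x := ⟨δ, hδ⟩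
  rw [lift, dif_pos h]
  exact append_congr p (hU.homotopic _ _ h.somePath_mem hδ)

variable {U V : Set M} {p : UniversalCover o}

theorem lift_proj (hU : IsDisk U) (hp : p.proj ∈ U) {x : M} (hx : x ∈ U) :
    (p.lift U x).proj = x := by
  obtain ⟨δ, hδ⟩ := hU.joinedIn _ hp _ hx
  rw [lift_eq_append hU p δ hδ, append]

theorem lift_self (hU : IsDisk U) (hp : p.proj ∈ U) : p.lift U p.proj = p := by
  rw [lift_eq_append hU p (Path.refl _) (fun _ => hp), append_refl]

theorem lift_append (hU : IsDisk U) {x y : M} (δ : Path p.proj x) (hδ : ∀ t, δ t ∈ U)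
    (hy : y ∈ U) : (p.append δ).lift U y = p.lift U y := by
  have hx : x ∈ U := by simpa using hδ 1
  obtain ⟨ε, hε⟩ := hU.joinedIn _ hx _ hy
  rw [lift_eq_append hU (p.append δ) ε hε, append_append, lift_eq_append hU]
  intro t
  have : δ.trans ε t ∈ range (δ.trans ε) := mem_range_self t
  rw [Path.trans_range] at this
  rcases this with ⟨s, hs⟩ | ⟨s, hs⟩
  · exact hs ▸ hδ s
  · exact hs ▸ hε s

theorem lift_lift (hU : IsDisk U) (hp : p.proj ∈ U) {x y : M} (hx : x ∈ U) (hy : y ∈ U) :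
    (p.lift U x).lift U y = p.lift U y := by
  obtain ⟨δ, hδ⟩ := hU.joinedIn _ hp _ hx
  rw [lift_eq_append hU p δ hδ, lift_append hU δ hδ hy]

theorem lift_mono (hU : IsDisk U) (hV : IsDisk V) (hVU : V ⊆ U) (hp : p.proj ∈ V) {x : M}
    (hx : x ∈ V) : p.lift V x = p.lift U x := by
  obtain ⟨δ, hδ⟩ := hV.joinedIn _ hp _ hx
  rw [lift_eq_append hV p δ hδ, lift_eq_append hU p δ fun t => hVU (hδ t)]

theorem eq_lift_of_mem_sheet (hU : IsDisk U) {q : UniversalCover o} (hq : q ∈ p.sheet U) :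
    q.proj ∈ U ∧ q = p.lift U q.proj := by
  obtain ⟨δ, hδ, h⟩ := exists_eq_append hq
  refine ⟨by simpa using hδ 1, ?_⟩
  rw [lift_eq_append hU p δ hδ, ← h]

theorem coveringTransformation_lift (hU : IsDisk U) (hp : p.proj ∈ U) {x : M} (hx : x ∈ U)
    (τ : PiOne o) :
    coveringTransformation τ (p.lift U x) = (coveringTransformation τ p).lift U x := by
  obtain ⟨δ, hδ⟩ := hU.joinedIn _ hp _ hx
  rw [lift_eq_append hU p δ hδ, lift_eq_append hU (coveringTransformation τ p) δ hδ]
  simp only [coveringTransformation, append, Path.Homotopic.Quotient.trans_assoc']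

/-- Moving inside a sheet appends a short path on the right, while the lift of `μ` puts `P` on the
left, so associativity makes the two operations compatible. -/
theorem reflectionLift_lift (hU : IsDisk U) (hV : IsDisk V) (hp : p.proj ∈ U) {x : M}
    (hx : x ∈ U) (μ : C(M, M)) (P : Path o (μ o)) (hUV : ∀ y ∈ U, μ y ∈ V) :
    reflectionLift μ P (p.lift U x) = (reflectionLift μ P p).lift V (μ x) := by
  obtain ⟨δ, hδ⟩ := hU.joinedIn _ hp _ hx
  have h := lift_eq_append hV (reflectionLift μ P p) (x := μ x) (δ.map μ.continuous)
    fun t => hUV _ (hδ t)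
  rw [lift_eq_append hU p δ hδ, h]
  simp only [reflectionLift, append, Path.Homotopic.Quotient.trans_assoc',
    Path.Homotopic.Quotient.map_trans', Path.Homotopic.Quotient.mk_map]

variable (M) in
/-- Every point has arbitrarily small disk neighbourhoods. -/
def HasDisks : Prop :=
  ∀ (x : M) (W : Set M), W ∈ 𝓝 x → ∃ U ⊆ W, x ∈ U ∧ IsDisk U

/-- Only the generating sheets `q.sheet W` need testing. From `x`, a path in a small disk inside `U
∩ W` serves twice: it computes the lift over `U`, and it extends the path from `q` without leaving
`W`. -/
theorem continuousAt_lift (hM : HasDisks M) (hU : IsDisk U) (hp : p.proj ∈ U) {x : M}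
    (hx : x ∈ U) : ContinuousAt (p.lift U) x := by
  refine TopologicalSpace.tendsto_nhds_generateFrom_iff.2 ?_
  rintro _ ⟨q, W, hW, -, rfl⟩ hmem
  obtain ⟨δ, hδ, h⟩ := exists_eq_append hmem
  have hxW : x ∈ W := by
    have := hδ 1
    rwa [δ.target, lift_proj hU hp hx] at this
  obtain ⟨V, hVs, hxV, hV⟩ := hM x (U ∩ W) ((hU.isOpen.inter hW).mem_nhds ⟨hx, hxW⟩)
  filter_upwards [hV.isOpen.mem_nhds hxV] with y hy
  obtain ⟨ε, hε⟩ := hV.joinedIn (p.lift U x).proj (by rwa [lift_proj hU hp hx]) y hy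
  have h1 : p.lift U y = (p.lift U x).append ε := by
    rw [← lift_lift hU hp hx (hVs hy).1]
    exact lift_eq_append hU _ ε fun t => (hVs (hε t)).1
  have h2 : p.lift U y = q.append (δ.trans ε) := by
    rw [h1, ← append_append]
    generalize p.lift U x = r at *
    cases r
    simp only [append] at h ⊢
    simp only [UniversalCover.mk.injEq, heq_eq_eq, true_and] at h
    rw [h]
  change p.lift U y ∈ q.sheet W
  rw [h2]
  refine append_mem_sheet _ _ fun t => ?_
  have : δ.trans ε t ∈ range (δ.trans ε) := mem_range_self t
  rw [Path.trans_range] at this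
  rcases this with ⟨s, hs⟩ | ⟨s, hs⟩
  · exact hs ▸ hδ s
  · exact hs ▸ (hVs (hε s)).2

theorem mk_cast_refl {a : M} (ha : a = o) :
    (⟨a, .mk ((Path.refl o).cast rfl ha)⟩ : UniversalCover o) = ⟨o, .mk (Path.refl o)⟩ := by
  subst ha
  rfl

theorem append_cast {x a b : M} (γ : Path o x) (ha : a = o) (hb : b = x) :
    (⟨a, .mk ((Path.refl o).cast rfl ha)⟩ : UniversalCover o).append (γ.cast ha hb) =
      ⟨x, .mk γ⟩ := by
  subst ha hb
  simp only [append, ← Path.Homotopic.Quotient.mk_trans, UniversalCover.mk.injEq, heq_eq_eq,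
    true_and]
  exact Path.Homotopic.Quotient.eq.2 ⟨Path.Homotopy.reflTrans γ⟩

/-- A function that is constant on small sheets is constant. -/
theorem eq_of_locally_eq {X : Type*} (K : UniversalCover o → X)
    (hK : ∀ p : UniversalCover o, ∃ U ∈ 𝓝 p.proj, ∀ q ∈ p.sheet U, K q = K p)
    (p q : UniversalCover o) : K p = K q := by
  suffices h : ∀ p, K p = K ⟨o, .mk (Path.refl o)⟩ by rw [h p, h q]
  rintro ⟨x, c⟩
  induction c using Path.Homotopic.Quotient.ind with | mk γ =>
  -- The constant class is based at `γ 0`, which equals `o` only propositionally, so that the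
  -- subpaths of `γ` can be appended to it. Then `f` is the lift of `γ`, and `K` is locally constant
  -- along it.
  let e : UniversalCover o := ⟨γ 0, .mk ((Path.refl o).cast rfl γ.source)⟩
  let f : unitInterval → UniversalCover o := fun t => e.append (γ.subpath 0 t)
  have hf : IsLocallyConstant fun t => K (f t) := by
    refine (IsLocallyConstant.iff_eventually_eq _).2 fun t => ?_
    obtain ⟨U, hU, h⟩ := hK (f t)
    have hV := tendsto_smallSets_iff.1
      ((tendsto_const_nhds (x := t)).uIcc (tendsto_id (x := 𝓝 t))) _
      (γ.continuous.continuousAt.preimage_mem_nhds hU)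
    filter_upwards [hV] with s hs
    have h2 : f s = (f t).append (y := γ s) (γ.subpath t s) := by
      rw [append_append]
      exact append_congr _ ⟨(Path.Homotopy.subpathTransSubpath γ 0 t s).symm⟩
    refine h _ ?_
    rw [h2]
    refine append_mem_sheet _ _ fun r => ?_
    have h1 : γ.subpath t s r ∈ range (γ.subpath t s) := mem_range_self r
    rw [Path.range_subpath] at h1
    obtain ⟨u, hu, h1⟩ := h1
    have h3 : γ u ∈ U := hs hu
    rw [h1] at h3
    exact h3
  have h01 := hf.apply_eq_of_isPreconnected isPreconnected_univ (mem_univ 1) (mem_univ 0)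
  have h1 : f 1 = ⟨x, .mk γ⟩ := by
    simp only [f, Path.subpath_zero_one]
    exact append_cast γ γ.source γ.target
  have h0 : f 0 = ⟨o, .mk (Path.refl o)⟩ := by
    simp only [f, Path.subpath_self]
    exact (append_refl e).trans (mk_cast_refl γ.source)
  simpa only [h1, h0] using h01

end UniversalCover

end Lift

/-! ### Coordinate disks -/

section Coordinate

variable {M : Type*} [TopologicalSpace M]

/-- Paths in the image are carried by `φ` to the ball, which is contractible; a homotopy found there
is mapped back by `φ.symm`. -/
theorem OpenPartialHomeomorph.isDisk_image_ball (φ : OpenPartialHomeomorph M ℂ) {c : ℂ} {r : ℝ}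
    (hr : 0 < r) (h : Metric.ball c r ⊆ φ.target) : IsDisk (φ.symm '' Metric.ball c r) := by
  have hconv := convex_ball c r
  have hne : (Metric.ball c r).Nonempty := ⟨c, Metric.mem_ball_self hr⟩
  have : ContractibleSpace (Metric.ball c r) := hconv.contractibleSpace hne
  have hcont : ContinuousOn φ.symm (Metric.ball c r) := φ.continuousOn_symm.mono h
  let f : C(Metric.ball c r, M) := ⟨_, hcont.domRestrict⟩
  have key : ∀ {x y : M} (γ : Path x y), (∀ t, γ t ∈ φ.symm '' Metric.ball c r) →
      ∀ (hx : x ∈ φ.symm '' Metric.ball c r) (hy : y ∈ φ.symm '' Metric.ball c r), ∃ γ' : Path (⟨φ x, by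
          obtain ⟨z, hz, rfl⟩ := hx; rwa [φ.right_inv (h hz)]⟩ : Metric.ball c r)
        ⟨φ y, by obtain ⟨z, hz, rfl⟩ := hy; rwa [φ.right_inv (h hz)]⟩, ∀ t, f (γ' t) = γ t := by
    intro x y γ hγ hx hy
    have hs : ∀ t, γ t ∈ φ.source := fun t => by
      obtain ⟨z, hz, e⟩ := hγ t
      exact e ▸ φ.map_target (h hz)
    refine ⟨⟨⟨fun t => ⟨φ (γ t), ?_⟩, ?_⟩, ?_, ?_⟩, ?_⟩
    · obtain ⟨z, hz, e⟩ := hγ t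
      rw [← e, φ.right_inv (h hz)]
      exact hz
    · exact (φ.continuousOn.comp_continuous γ.continuous hs).subtype_mk _
    · simp
    · simp
    · intro t
      exact φ.left_inv (hs t)
  refine ⟨φ.symm.isOpen_image_of_subset_source Metric.isOpen_ball h, ?_, ?_⟩
  · exact fun x hx y hy =>
      ((hconv.isPathConnected hne).image' (hcont)).joinedIn x hx y hy
  · intro x y γ δ hγ hδ
    have hx : x ∈ φ.symm '' Metric.ball c r := by simpa using hγ 0
    have hy : y ∈ φ.symm '' Metric.ball c r := by simpa using hγ 1
    obtain ⟨γ', h1⟩ := key γ hγ hx hy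
    obtain ⟨δ', h2⟩ := key δ hδ hx hy
    have h3 := (SimplyConnectedSpace.paths_homotopic γ' δ').map f
    have hs : ∀ x ∈ φ.symm '' Metric.ball c r, φ.symm (φ x) = x := by
      rintro _ ⟨z, hz, rfl⟩
      rw [φ.right_inv (h hz)]
    have h4 := h3.pathCast (hs x hx).symm (hs y hy).symm
    convert h4 using 1
    · ext t; exact (h1 t).symm
    · ext t; exact (h2 t).symm

theorem hasDisks [ChartedSpace ℂ M] : UniversalCover.HasDisks M := by
  intro x W hW
  let φ := chartAt ℂ x
  have hx : x ∈ φ.source := mem_chart_source ℂ x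
  have h1 : φ.symm ⁻¹' W ∈ 𝓝 (φ x) :=
    φ.tendsto_symm hx hW
  obtain ⟨r, hr, hb⟩ := Metric.mem_nhds_iff.1
    (inter_mem (φ.open_target.mem_nhds (φ.map_source hx)) h1)
  refine ⟨φ.symm '' Metric.ball (φ x) r, ?_, ⟨φ x, Metric.mem_ball_self hr, φ.left_inv hx⟩,
    φ.isDisk_image_ball hr fun z hz => (hb hz).1⟩
  rintro _ ⟨z, hz, rfl⟩
  exact (hb hz).2

end Coordinate

/-! ### Homogeneous coordinates on the Riemann sphere -/

/-- The point `[u : v]` of the Riemann sphere. -/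
def spherePoint (u v : ℂ) : OnePoint ℂ := if v = 0 then OnePoint.infty else ((u / v : ℂ) : OnePoint ℂ)

theorem spherePoint_one (u : ℂ) : spherePoint u 1 = (u : OnePoint ℂ) := by
  simp [spherePoint]

/-- Cross-multiplication treats `∞` like any other point, so equality of sphere-valued maps becomes
an equation between holomorphic functions. -/
theorem spherePoint_eq_iff {u v u' v' : ℂ} (h : u ≠ 0 ∨ v ≠ 0) (h' : u' ≠ 0 ∨ v' ≠ 0) :
    spherePoint u v = spherePoint u' v' ↔ u * v' = u' * v := by
  unfold spherePoint
  by_cases hv : v = 0 <;> by_cases hv' : v' = 0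
  · simp [hv, hv']
  · simp_all
  · simp_all
  · simp only [hv, hv', if_false, OnePoint.coe_eq_coe]
    rw [div_eq_div_iff hv hv']

theorem SL2_mulVec_ne_zero (σ : SL(2, ℂ)) {u v : ℂ} (h : u ≠ 0 ∨ v ≠ 0) :
    σ 0 0 * u + σ 0 1 * v ≠ 0 ∨ σ 1 0 * u + σ 1 1 * v ≠ 0 := by
  by_contra! hc
  have hdet := σ.det_coe
  rw [Matrix.det_fin_two] at hdet
  have hu : u = 0 := by linear_combination σ 1 1 * hc.1 - σ 0 1 * hc.2 - u * hdet
  have hv : v = 0 := by linear_combination σ 0 0 * hc.2 - σ 1 0 * hc.1 - v * hdet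
  simp_all

theorem smul_spherePoint (σ : SL(2, ℂ)) {u v : ℂ} (h : u ≠ 0 ∨ v ≠ 0) :
    (σ : GL (Fin 2) ℂ) • spherePoint u v =
      spherePoint (σ 0 0 * u + σ 0 1 * v) (σ 1 0 * u + σ 1 1 * v) := by
  by_cases hv : v = 0
  · have hu : u ≠ 0 := by simpa [hv] using h
    by_cases hc : σ 1 0 = 0
    · simp [spherePoint, hv, OnePoint.smul_infty_eq_ite, hc]
    · simp [spherePoint, hv, OnePoint.smul_infty_eq_ite, hc, hu, mul_div_mul_right]
  · have e : σ 1 0 * (u / v) + σ 1 1 = (σ 1 0 * u + σ 1 1 * v) / v := by field_simp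
    have e' : σ 0 0 * (u / v) + σ 0 1 = (σ 0 0 * u + σ 0 1 * v) / v := by field_simp
    by_cases hc : σ 1 0 * u + σ 1 1 * v = 0
    · simp [spherePoint, hv, OnePoint.smul_some_eq_ite, e, hc]
    · simp only [spherePoint, hv, OnePoint.smul_some_eq_ite, hc, if_false,
        Matrix.SpecialLinearGroup.coe_GL_coe_matrix]
      simp [e, e', hc, hv, div_div_div_cancel_right₀]

theorem map_conj_spherePoint (u v : ℂ) :
    (spherePoint u v).map conj = spherePoint (conj u) (conj v) := by
  by_cases hv : v = 0 <;> simp [spherePoint, hv]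

/-! ### Holomorphic maps to the sphere -/

section Sphere

variable {M : Type*} [TopologicalSpace M] [ChartedSpace ℂ M]

/-- In every coordinate, `G` is locally `[u : v]` with `u` and `v` holomorphic. -/
def IsSphereHolomorphic (G : M → OnePoint ℂ) : Prop :=
  ∀ φ ∈ atlas ℂ M, ∀ z ∈ φ.target, ∃ u v : ℂ → ℂ, AnalyticAt ℂ u z ∧ AnalyticAt ℂ v z ∧
    ∀ᶠ w in 𝓝 z, (u w ≠ 0 ∨ v w ≠ 0) ∧ G (φ.symm w) = spherePoint (u w) (v w)

theorem IsMeromorphicFunction.isSphereHolomorphic {G : M → OnePoint ℂ}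
    (hG : IsMeromorphicFunction G) : IsSphereHolomorphic G := by
  intro φ hφ z hz
  have hcont : ContinuousAt (fun w => G (φ.symm w)) z :=
    hG.continuous.continuousAt.comp (φ.continuousAt_symm hz)
  have hopen : ∀ c : OnePoint ℂ, G (φ.symm z) ≠ c →
      ∀ᶠ w in 𝓝 z, w ∈ φ.target ∧ G (φ.symm w) ≠ c := fun c hc =>
    inter_mem (φ.open_target.mem_nhds hz) (hcont.eventually_ne hc)
  by_cases h : G (φ.symm z) = OnePoint.infty
  · have h0 := hopen ((0 : ℂ) : OnePoint ℂ) (by simp [h])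
    refine ⟨fun _ => 1, fun w => sphereInvVal (G (φ.symm w)), analyticAt_const, ?_, ?_⟩
    · exact Complex.analyticAt_iff_eventually_differentiableAt.2
        (h0.mono fun w hw => hG.holomorphic_inv φ hφ w hw.1 hw.2)
    · filter_upwards [h0] with w hw
      refine ⟨by simp, ?_⟩
      have := hw.2
      generalize G (φ.symm w) = c at *
      induction c using OnePoint.rec with
      | infty => simp [spherePoint, sphereInvVal]
      | coe c =>
        have : c ≠ 0 := by simpa using this
        simp [spherePoint, sphereInvVal, this]
  · have h0 := hopen OnePoint.infty h
    refine ⟨fun w => sphereVal (G (φ.symm w)), fun _ => 1, ?_, analyticAt_const, ?_⟩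
    · exact Complex.analyticAt_iff_eventually_differentiableAt.2
        (h0.mono fun w hw => hG.holomorphic φ hφ w hw.1 hw.2)
    · filter_upwards [h0] with w hw
      refine ⟨by simp, ?_⟩
      rw [spherePoint_one]
      have := hw.2
      generalize G (φ.symm w) = c at *
      induction c using OnePoint.rec with
      | infty => simp at this
      | coe c => simp [sphereVal]

theorem isSphereHolomorphic_const (c : OnePoint ℂ) :
    IsSphereHolomorphic (fun _ : M => c) := by
  intro φ _ z _
  induction c using OnePoint.rec with
  | infty => exact ⟨fun _ => 1, fun _ => 0, analyticAt_const, analyticAt_const,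
      .of_forall fun w => by simp [spherePoint]⟩
  | coe c => exact ⟨fun _ => c, fun _ => 1, analyticAt_const, analyticAt_const,
      .of_forall fun w => by simp [spherePoint]⟩

theorem IsSphereHolomorphic.smul {G : M → OnePoint ℂ} (hG : IsSphereHolomorphic G) (σ : SL(2, ℂ)) :
    IsSphereHolomorphic fun x => (σ : GL (Fin 2) ℂ) • G x := by
  intro φ hφ z hz
  obtain ⟨u, v, hu, hv, h⟩ := hG φ hφ z hz
  refine ⟨fun w => σ 0 0 * u w + σ 0 1 * v w, fun w => σ 1 0 * u w + σ 1 1 * v w,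
    by fun_prop, by fun_prop, ?_⟩
  filter_upwards [h] with w hw
  exact ⟨SL2_mulVec_ne_zero σ hw.1, by rw [hw.2, smul_spherePoint σ hw.1]⟩

theorem IsSphereHolomorphic.eventually_eq {G H : M → OnePoint ℂ} (hG : IsSphereHolomorphic G)
    (hH : IsSphereHolomorphic H) {φ : OpenPartialHomeomorph M ℂ} (hφ : φ ∈ atlas ℂ M) {z : ℂ}
    (hz : z ∈ φ.target) (h : ∃ᶠ w in 𝓝[≠] z, G (φ.symm w) = H (φ.symm w)) :
    ∀ᶠ w in 𝓝 z, G (φ.symm w) = H (φ.symm w) := by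
  obtain ⟨u, v, hu, hv, huv⟩ := hG φ hφ z hz
  obtain ⟨u', v', hu', hv', huv'⟩ := hH φ hφ z hz
  have key : ∀ᶠ w in 𝓝 z, (G (φ.symm w) = H (φ.symm w) ↔ u w * v' w = u' w * v w) := by
    filter_upwards [huv, huv'] with w h1 h2
    rw [h1.2, h2.2, spherePoint_eq_iff h1.1 h2.1]
  have hf : ∃ᶠ w in 𝓝[≠] z, u w * v' w = u' w * v w :=
    (h.and_eventually (key.filter_mono nhdsWithin_le_nhds)).mono fun w hw => hw.2.1 hw.1
  have := (AnalyticAt.frequently_eq_iff_eventually_eq (hu.mul hv') (hu'.mul hv)).1 hf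
  filter_upwards [this, key] with w h1 h2
  exact h2.2 h1

/-- The identity theorem for holomorphic maps to the sphere. -/
theorem IsSphereHolomorphic.eq_of_frequently_eq [ConnectedSpace M] {G H : M → OnePoint ℂ}
    (hG : IsSphereHolomorphic G) (hH : IsSphereHolomorphic H) {φ : OpenPartialHomeomorph M ℂ}
    (hφ : φ ∈ atlas ℂ M) {z : ℂ} (hz : z ∈ φ.target)
    (h : ∃ᶠ w in 𝓝[≠] z, G (φ.symm w) = H (φ.symm w)) (x : M) : G x = H x := by
  -- `E` is open by definition. It is closed because at a point of its closure outside `E` the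
  -- agreement accumulates, and the local identity theorem puts the point in `E`.
  let E : Set M := {x | ∀ᶠ y in 𝓝 x, G y = H y}
  have transfer : ∀ ψ : OpenPartialHomeomorph M ℂ, ∀ w ∈ ψ.target,
      (∀ᶠ t in 𝓝 w, G (ψ.symm t) = H (ψ.symm t)) → ψ.symm w ∈ E := by
    intro ψ w hw h
    have h1 := (ψ.continuousAt (ψ.map_target hw)).eventually (by rwa [ψ.right_inv hw])
    filter_upwards [h1, ψ.open_source.mem_nhds (ψ.map_target hw)] with y hy hys
    rwa [ψ.left_inv hys] at hy
  have hne : E.Nonempty := ⟨_, transfer φ z hz (hG.eventually_eq hH hφ hz h)⟩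
  have hopen : IsOpen E := isOpen_setOfPred_eventually_nhds
  have hclosed : IsClosed E := by
    refine isClosed_of_closure_subset fun x hx => ?_
    by_contra hxE
    let ψ := chartAt ℂ x
    have hxs : x ∈ ψ.source := mem_chart_source ℂ x
    have hfr : ∃ᶠ y in 𝓝 x, y ∈ E := mem_closure_iff_frequently.1 hx
    have hmem : ψ.symm (ψ x) ∈ E := by
      refine transfer ψ (ψ x) (ψ.map_source hxs)
        (hG.eventually_eq hH (chart_mem_atlas ℂ x) (ψ.map_source hxs) ?_)
      intro hev
      refine hfr ?_
      have h1 : ∀ᶠ y in 𝓝 x, ψ y ≠ ψ x → ¬ G (ψ.symm (ψ y)) = H (ψ.symm (ψ y)) :=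
        (ψ.continuousAt hxs).eventually (eventually_nhdsWithin_iff.1 hev)
      filter_upwards [h1, ψ.open_source.mem_nhds hxs] with y hy hys hyE
      by_cases hyx : y = x
      · exact hxE (hyx ▸ hyE)
      · have := hy fun e => hyx (ψ.injOn hys hxs e)
        rw [ψ.left_inv hys] at this
        exact this hyE.self_of_nhds
    rw [ψ.left_inv hxs] at hmem
    exact hxE hmem
  have : E = univ := IsClopen.eq_univ ⟨hclosed, hopen⟩ hne
  exact (this ▸ mem_univ x : x ∈ E).self_of_nhds

/-- The poles and the critical points of a nonconstant map to the sphere are isolated. -/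
theorem IsSphereHolomorphic.eventually_isRegularAt [ConnectedSpace M] {G : M → OnePoint ℂ}
    (hG : IsSphereHolomorphic G) (hne : ¬ ∃ c, ∀ x, G x = c) {φ : OpenPartialHomeomorph M ℂ}
    (hφ : φ ∈ atlas ℂ M) {z : ℂ} (hz : z ∈ φ.target) :
    ∀ᶠ w in 𝓝[≠] z, w ∈ φ.target ∧ IsRegularAt G φ w ∧
      DifferentiableAt ℂ (fun t => sphereVal (G (φ.symm t))) w := by
  obtain ⟨u, v, hu, hv, huv⟩ := hG φ hφ z hz
  have hv0 : ∀ᶠ w in 𝓝[≠] z, v w ≠ 0 := by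
    rcases hv.eventually_eq_zero_or_eventually_ne_zero with h | h
    · refine (hne ⟨OnePoint.infty, hG.eq_of_frequently_eq (isSphereHolomorphic_const _) hφ hz ?_⟩).elim
      refine (Eventually.filter_mono nhdsWithin_le_nhds ?_).frequently
      filter_upwards [h, huv] with w h1 h2
      rw [h2.2, h1, spherePoint, if_pos rfl]
    · exact h
  have hquot : ∀ᶠ w in 𝓝[≠] z, ∀ᶠ t in 𝓝 w, v t ≠ 0 ∧ AnalyticAt ℂ u t ∧ AnalyticAt ℂ v t ∧
      G (φ.symm t) = ((u t / v t : ℂ) : OnePoint ℂ) := by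
    have : ∀ᶠ w in 𝓝[≠] z, v w ≠ 0 ∧ AnalyticAt ℂ u w ∧ AnalyticAt ℂ v w ∧
      G (φ.symm w) = ((u w / v w : ℂ) : OnePoint ℂ) := by
      filter_upwards [hv0, huv.filter_mono nhdsWithin_le_nhds,
        hu.eventually_analyticAt.filter_mono nhdsWithin_le_nhds,
        hv.eventually_analyticAt.filter_mono nhdsWithin_le_nhds] with w h1 h2 h3 h4
      exact ⟨h1, h3, h4, by rw [h2.2, spherePoint, if_neg h1]⟩
    filter_upwards [eventually_eventually_nhdsWithin.2 this, self_mem_nhdsWithin] with w hw hwz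
    rwa [isOpen_compl_singleton.nhdsWithin_eq hwz] at hw
  have hderiv : ∀ᶠ w in 𝓝[≠] z, ∀ᶠ t in 𝓝 w, G (φ.symm t) = ((u t / v t : ℂ) : OnePoint ℂ) ∧
      HasDerivAt (fun s => u s / v s) ((deriv u t * v t - u t * deriv v t) / v t ^ 2) t := by
    filter_upwards [hquot] with w hw
    filter_upwards [hw] with t ht
    exact ⟨ht.2.2.2, ht.2.1.differentiableAt.hasDerivAt.div
      ht.2.2.1.differentiableAt.hasDerivAt ht.1⟩
  -- This Wronskian is the numerator of `(u / v)'`. If it vanished near `z`, then `G` would be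
  -- constant on a small ball, hence on `M`; otherwise its zeros are isolated.
  have hW : AnalyticAt ℂ (fun w => deriv u w * v w - u w * deriv v w) z :=
    (hu.deriv.mul hv).sub (hu.mul hv.deriv)
  rcases hW.eventually_eq_zero_or_eventually_ne_zero with h | h
  · exfalso
    have h' : ∀ᶠ w in 𝓝[≠] z, ∀ᶠ t in 𝓝 w, deriv u t * v t - u t * deriv v t = 0 :=
      h.eventually_nhds.filter_mono nhdsWithin_le_nhds
    obtain ⟨w, ⟨hw, hw'⟩, hwt⟩ := ((hderiv.and h').and
      (nhdsWithin_le_nhds (φ.open_target.mem_nhds hz))).exists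
    obtain ⟨r, hr, hb⟩ := Metric.eventually_nhds_iff_ball.1 (hw.and hw')
    have hd : ∀ t ∈ Metric.ball w r, HasDerivAt (fun s => u s / v s) 0 t := fun t ht => by
      have := (hb t ht).1.2
      rwa [(hb t ht).2, zero_div] at this
    have hconst : ∀ t ∈ Metric.ball w r, u t / v t = u w / v w := fun t ht =>
      Metric.isOpen_ball.is_const_of_deriv_eq_zero (convex_ball w r).isPreconnected
        (fun s hs => (hd s hs).differentiableAt.differentiableWithinAt)
        (fun s hs => (hd s hs).deriv) ht (Metric.mem_ball_self hr)
    refine hne ⟨((u w / v w : ℂ) : OnePoint ℂ),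
      hG.eq_of_frequently_eq (isSphereHolomorphic_const _) hφ hwt ?_⟩
    refine (Eventually.filter_mono nhdsWithin_le_nhds ?_).frequently
    filter_upwards [Metric.ball_mem_nhds w hr] with t ht
    rw [(hb t ht).1.1, hconst t ht]
  · filter_upwards [h, hderiv, hquot, nhdsWithin_le_nhds (φ.open_target.mem_nhds hz)]
      with w h1 h2 h3 h4
    have h5 : (fun t => sphereVal (G (φ.symm t))) =ᶠ[𝓝 w] fun t => u t / v t := by
      filter_upwards [h2] with t ht
      rw [ht.1]
      rfl
    have h6 := h2.self_of_nhds.2.congr_of_eventuallyEq h5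
    refine ⟨h4, ⟨?_, ?_⟩, h6.differentiableAt⟩
    · rw [h2.self_of_nhds.1]
      exact OnePoint.coe_ne_infty _
    · rw [coordDeriv, h6.deriv]
      exact div_ne_zero h1 (pow_ne_zero _ h3.self_of_nhds.1)

omit [ChartedSpace ℂ M] in
theorem IsRegularAt.not_const {G : M → OnePoint ℂ} {φ : OpenPartialHomeomorph M ℂ} {z : ℂ}
    (h : IsRegularAt G φ z) : ¬ ∃ c, ∀ x, G x = c := by
  rintro ⟨c, hc⟩
  exact h.2 (by simp [coordDeriv, hc])

end Sphere

/-! ### Local rigidity -/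

/-- This is the operator `∂/∂z` applied to the identity; it does not see the antiholomorphic
factors. It is obtained from the real derivatives in the directions `1` and `i`, which give `X + Y =
0` and `i (X - Y) = 0`. -/
theorem sum_deriv_mul_conj_eq_zero {ι : Type*} [Fintype ι] {U : Set ℂ} (hU : IsOpen U)
    {a b : ι → ℂ → ℂ} (ha : ∀ k, DifferentiableOn ℂ (a k) U)
    (hb : ∀ k, DifferentiableOn ℂ (b k) U) (h : ∀ z ∈ U, ∑ k, a k z * conj (b k z) = 0) :
    ∀ z ∈ U, ∑ k, deriv (a k) z * conj (b k z) = 0 := by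
  intro z hz
  have key : ∀ e : ℂ, ∑ k, (deriv (a k) z * e * conj (b k z) +
      a k z * conj (deriv (b k) z * e)) = 0 := by
    intro e
    have hline : ∀ f : ℂ → ℂ, DifferentiableOn ℂ f U →
        HasDerivAt (fun t : ℝ => f (z + t * e)) (deriv f z * e) 0 := by
      intro f hf
      have h1 : HasDerivAt f (deriv f z) (z + ((0 : ℝ) : ℂ) * e) := by
        simpa using (hf.differentiableAt (hU.mem_nhds hz)).hasDerivAt
      have h2 : HasDerivAt (fun t : ℂ => z + t * e) e ((0 : ℝ) : ℂ) := by
        simpa using ((hasDerivAt_id ((0 : ℝ) : ℂ)).mul_const e).const_add z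
      exact (HasDerivAt.comp (h := fun t : ℂ => z + t * e) _ h1 h2).comp_ofReal
    have hsum : HasDerivAt (fun t : ℝ => ∑ k, a k (z + t * e) * conj (b k (z + t * e)))
        (∑ k, (deriv (a k) z * e * conj (b k (z + (0 : ℝ) * e)) +
          a k (z + (0 : ℝ) * e) * conj (deriv (b k) z * e))) 0 :=
      HasDerivAt.fun_sum fun k _ => (hline _ (ha k)).mul (hline _ (hb k)).star
    have hev : (fun t : ℝ => ∑ k, a k (z + t * e) * conj (b k (z + t * e))) =ᶠ[𝓝 0] fun _ => 0 := by
      have hc : Continuous fun t : ℝ => z + t * e := by fun_prop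
      filter_upwards [hc.continuousAt.preimage_mem_nhds (hU.mem_nhds (by simpa using hz))] with t ht
      exact h _ ht
    have := hsum.unique ((hasDerivAt_const (0 : ℝ) (0 : ℂ)).congr_of_eventuallyEq hev)
    simpa using this
  have h1 := key 1
  have hI := key Complex.I
  simp only [map_mul, mul_one, Complex.conj_I, Finset.sum_add_distrib] at h1 hI
  have e1 : ∑ k, deriv (a k) z * Complex.I * conj (b k z) =
      Complex.I * ∑ k, deriv (a k) z * conj (b k z) := by
    rw [Finset.mul_sum]; exact Finset.sum_congr rfl fun _ _ => by ring
  have e2 : ∑ k, a k z * (conj (deriv (b k) z) * -Complex.I) =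
      -Complex.I * ∑ k, a k z * conj (deriv (b k) z) := by
    rw [Finset.mul_sum]; exact Finset.sum_congr rfl fun _ _ => by ring
  rw [e1, e2] at hI
  generalize ∑ k, deriv (a k) z * conj (b k z) = X at *
  generalize ∑ k, a k z * conj (deriv (b k) z) = Y at *
  linear_combination (1 / 2) * h1 - (Complex.I / 2) * hI + (1 / 2) * (X - Y) * Complex.I_sq

/-- Polarization: a sesquiholomorphic expression that vanishes on the diagonal vanishes. -/
theorem sum_mul_conj_eq_zero_of_diagonal {ι : Type*} [Fintype ι] {c : ℂ} {r : ℝ} (hr : 0 < r)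
    {a b : ι → ℂ → ℂ} (ha : ∀ k, DifferentiableOn ℂ (a k) (Metric.ball c r))
    (hb : ∀ k, DifferentiableOn ℂ (b k) (Metric.ball c r))
    (h : ∀ z ∈ Metric.ball c r, ∑ k, a k z * conj (b k z) = 0) :
    ∀ z ∈ Metric.ball c r, ∑ k, a k z * conj (b k c) = 0 := by
  -- The family `a` is generalized in the induction, since the family of derivatives satisfies the
  -- same diagonal identity. Thus every Taylor coefficient at `c` vanishes.
  have hd : ∀ n, ∀ a : ι → ℂ → ℂ, (∀ k, DifferentiableOn ℂ (a k) (Metric.ball c r)) →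
      (∀ z ∈ Metric.ball c r, ∑ k, a k z * conj (b k z) = 0) →
      iteratedDeriv n (fun z => ∑ k, a k z * conj (b k c)) c = 0 := by
    intro n
    induction n with
    | zero =>
      intro a _ h
      simpa using h c (Metric.mem_ball_self hr)
    | succ n ih =>
      intro a ha h
      rw [iteratedDeriv_succ']
      have he : deriv (fun z => ∑ k, a k z * conj (b k c)) =ᶠ[𝓝 c]
          fun z => ∑ k, deriv (a k) z * conj (b k c) := by
        filter_upwards [Metric.ball_mem_nhds c hr] with z hz
        exact (HasDerivAt.fun_sum fun k _ => ((ha k).differentiableAt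
          (Metric.isOpen_ball.mem_nhds hz)).hasDerivAt.mul_const _).deriv
      rw [he.iteratedDeriv_eq]
      exact ih (fun k => deriv (a k)) (fun k => (ha k).deriv Metric.isOpen_ball)
        (sum_deriv_mul_conj_eq_zero Metric.isOpen_ball ha hb h)
  intro z hz
  have hA : DifferentiableOn ℂ (fun z => ∑ k, a k z * conj (b k c)) (Metric.ball c r) :=
    DifferentiableOn.fun_sum fun k _ => (ha k).mul_const _
  have hs := Complex.hasSum_taylorSeries_on_ball hA hz
  simp only [hd _ a ha h, smul_zero] at hs
  exact hs.unique hasSum_zero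

theorem exists_SL2_smul (a b c d : ℂ) (h : a * d - b * c ≠ 0) :
    ∃ s : ℂ, s ≠ 0 ∧ ∃ σ : SL(2, ℂ), σ 0 0 = s * a ∧ σ 0 1 = s * b ∧ σ 1 0 = s * c ∧
      σ 1 1 = s * d := by
  obtain ⟨s, hs⟩ := IsAlgClosed.exists_pow_nat_eq ((a * d - b * c)⁻¹) (n := 2) (by norm_num)
  have hs0 : s ≠ 0 := by
    rintro rfl
    exact inv_ne_zero h (by simpa using hs.symm)
  refine ⟨s, hs0, ⟨!![s * a, s * b; s * c, s * d], ?_⟩, rfl, rfl, rfl, rfl⟩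
  rw [Matrix.det_fin_two_of]
  calc _ = s ^ 2 * (a * d - b * c) := by ring
    _ = 1 := by rw [hs, inv_mul_cancel₀ h]

/-- The squared identity is polynomial in holomorphic functions and their conjugates. Polarization
freezes the conjugates at `c`; what remains says that `g' / (1 + g * conj (g c))²` and `h' / (1 + h
* conj (h c))²` are proportional. Both have Möbius primitives in `g` and `h`, so `h` is a Möbius
function of `g`. -/
theorem exists_smul_eq_of_metric_eq {g h : ℂ → ℂ} {c : ℂ} {r : ℝ} (hr : 0 < r)
    (hg : DifferentiableOn ℂ g (Metric.ball c r)) (hh : DifferentiableOn ℂ h (Metric.ball c r))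
    (hg0 : deriv g c ≠ 0) (hm : ∀ z ∈ Metric.ball c r,
      ‖deriv g z‖ * (1 + ‖h z‖ ^ 2) = ‖deriv h z‖ * (1 + ‖g z‖ ^ 2)) :
    ∃ σ : SL(2, ℂ), ∀ᶠ z in 𝓝 c,
      (h z : OnePoint ℂ) = (σ : GL (Fin 2) ℂ) • (g z : OnePoint ℂ) := by
  have hgd := hg.deriv Metric.isOpen_ball
  have hhd := hh.deriv Metric.isOpen_ball
  have hnn : ∀ w : ℂ, (1 : ℂ) + w * conj w ≠ 0 := fun w => by
    rw [Complex.mul_conj']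
    norm_cast
    positivity
  have hh0 : deriv h c ≠ 0 := by
    intro h0
    have := hm c (Metric.mem_ball_self hr)
    rw [h0, norm_zero, zero_mul] at this
    have h2 : (0 : ℝ) < 1 + ‖h c‖ ^ 2 := by positivity
    exact hg0 (norm_eq_zero.1 ((mul_eq_zero.1 this).resolve_right h2.ne'))
  have hm' : ∀ z ∈ Metric.ball c r, deriv g z * conj (deriv g z) * (1 + h z * conj (h z)) ^ 2 =
      deriv h z * conj (deriv h z) * (1 + g z * conj (g z)) ^ 2 := fun z hz => by
    simp only [Complex.mul_conj']
    have := congrArg (fun t : ℝ => ((t ^ 2 : ℝ) : ℂ)) (hm z hz)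
    push_cast at this
    linear_combination this
  have hpol : ∀ z ∈ Metric.ball c r,
      deriv g z * conj (deriv g c) * (1 + h z * conj (h c)) ^ 2 =
      deriv h z * conj (deriv h c) * (1 + g z * conj (g c)) ^ 2 := by
    -- The six terms come from expanding the two squares; the coefficient `2` is put on the
    -- holomorphic side.
    have := sum_mul_conj_eq_zero_of_diagonal (ι := Fin 6) hr
      (a := ![fun z => deriv g z, fun z => 2 * (deriv g z * h z), fun z => deriv g z * h z ^ 2,
        fun z => -deriv h z, fun z => -(2 * (deriv h z * g z)), fun z => -(deriv h z * g z ^ 2)])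
      (b := ![fun z => deriv g z, fun z => deriv g z * h z, fun z => deriv g z * h z ^ 2,
        fun z => deriv h z, fun z => deriv h z * g z, fun z => deriv h z * g z ^ 2])
      (by intro k; fin_cases k <;> simp <;> fun_prop)
      (by intro k; fin_cases k <;> simp <;> fun_prop)
      (by
        intro z hz
        simp [Fin.sum_univ_succ]
        linear_combination hm' z hz)
    intro z hz
    have h1 := this z hz
    simp [Fin.sum_univ_succ] at h1
    linear_combination h1
  -- The factors `1 + |h c|²` and `1 + |g c|²` are crossed because differentiating `(g - g c) / (1 +
  -- g * conj (g c))` produces `1 + |g c|²`, and likewise for `h`.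
  set α := conj (deriv g c) * (1 + h c * conj (h c)) with hα
  set β := conj (deriv h c) * (1 + g c * conj (g c)) with hβ
  have hα0 : α ≠ 0 := mul_ne_zero (by simpa using hg0) (hnn _)
  have hβ0 : β ≠ 0 := mul_ne_zero (by simpa using hh0) (hnn _)
  have hcm := Metric.ball_mem_nhds c hr
  have hc1 : ∀ᶠ z in 𝓝 c, 1 + g z * conj (g c) ≠ 0 :=
    ContinuousAt.eventually_ne (((hg.differentiableAt hcm).continuousAt.mul_const _).const_add _) (hnn _)
  have hc2 : ∀ᶠ z in 𝓝 c, 1 + h z * conj (h c) ≠ 0 :=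
    ContinuousAt.eventually_ne (((hh.differentiableAt hcm).continuousAt.mul_const _).const_add _) (hnn _)
  obtain ⟨ε, hε, hb⟩ := Metric.eventually_nhds_iff_ball.1
    ((hc1.and hc2).and (Metric.isOpen_ball.mem_nhds (Metric.mem_ball_self hr)))
  have hder : ∀ z ∈ Metric.ball c ε, HasDerivAt (fun z => α * ((g z - g c) / (1 + g z * conj (g c)))
      - β * ((h z - h c) / (1 + h z * conj (h c)))) 0 z := by
    intro z hz
    obtain ⟨⟨h1, h2⟩, h3⟩ := hb z hz
    have d1 := (hg.differentiableAt (Metric.isOpen_ball.mem_nhds h3)).hasDerivAt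
    have d2 := (hh.differentiableAt (Metric.isOpen_ball.mem_nhds h3)).hasDerivAt
    have := (((d1.sub_const (g c)).fun_div ((d1.mul_const (conj (g c))).const_add 1) h1).const_mul
      α).fun_sub (((d2.sub_const (h c)).fun_div ((d2.mul_const (conj (h c))).const_add 1) h2).const_mul β)
    refine this.congr_deriv ?_
    have hp := hpol z h3
    rw [← mul_div_assoc, ← mul_div_assoc, div_sub_div _ _ (pow_ne_zero _ h1) (pow_ne_zero _ h2),
      div_eq_zero_iff]
    left
    rw [hα, hβ]
    linear_combination (1 + g c * conj (g c)) * (1 + h c * conj (h c)) * hp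
  have hrel : ∀ z ∈ Metric.ball c ε,
      α * (g z - g c) * (1 + h z * conj (h c)) = β * (h z - h c) * (1 + g z * conj (g c)) := by
    intro z hz
    have := Metric.isOpen_ball.is_const_of_deriv_eq_zero (convex_ball c ε).isPreconnected
        (fun s hs => (hder s hs).differentiableAt.differentiableWithinAt)
        (fun s hs => (hder s hs).deriv) hz (Metric.mem_ball_self hε)
    obtain ⟨⟨h1, h2⟩, h3⟩ := hb z hz
    simp only [sub_self, zero_div, mul_zero] at this
    field_simp at this
    linear_combination this
  -- The entries result from solving `hrel` for `h z`; the determinant is `α β (1 + |g c|²) (1 + |h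
  -- c|²)`.
  obtain ⟨s, hs, σ, e1, e2, e3, e4⟩ := exists_SL2_smul (α + β * h c * conj (g c))
    (β * h c - α * g c) (β * conj (g c) - α * conj (h c)) (β + α * conj (h c) * g c) (by
      have : α * β * (1 + g c * conj (g c)) * (1 + h c * conj (h c)) ≠ 0 :=
        mul_ne_zero (mul_ne_zero (mul_ne_zero hα0 hβ0) (hnn _)) (hnn _)
      convert this using 1
      ring)
  refine ⟨σ, ?_⟩
  filter_upwards [Metric.ball_mem_nhds c hε] with z hz
  rw [← spherePoint_one, ← spherePoint_one, smul_spherePoint σ (by simp), spherePoint_eq_iff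
    (by simp) (SL2_mulVec_ne_zero σ (by simp)), e1, e2, e3, e4]
  linear_combination -s * hrel z hz

/-! ### Linear differential equations on the universal covering -/

section Solutions

variable {M : Type*} [TopologicalSpace M] [ChartedSpace ℂ M] {o : M}

open UniversalCover

/-- `H` is holomorphic on the universal covering and solves `dH = A H` over the points of `S`. -/
def SolvesOn (A : OpenPartialHomeomorph M ℂ → ℂ → Matrix (Fin 2) (Fin 2) ℂ)
    (S : OpenPartialHomeomorph M ℂ → ℂ → Prop) (H : UniversalCover o → SL(2, ℂ)) : Prop :=
  ∀ (p : UniversalCover o) (U : Set M), IsDisk U → p.proj ∈ U → ∀ φ ∈ atlas ℂ M,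
    p.proj ∈ φ.source → ∃ D : Matrix (Fin 2) (Fin 2) ℂ,
      (∀ i j, HasDerivAt (fun z => H (p.lift U (φ.symm z)) i j) (D i j) (φ p.proj)) ∧
      (S φ (φ p.proj) → D = A φ (φ p.proj) * H p)

variable {A A' : OpenPartialHomeomorph M ℂ → ℂ → Matrix (Fin 2) (Fin 2) ℂ}
  {S S' : OpenPartialHomeomorph M ℂ → ℂ → Prop} {F H : UniversalCover o → SL(2, ℂ)}

omit [ChartedSpace ℂ M] in
theorem eventually_symm_mem {U : Set M} (hU : IsOpen U) {φ : OpenPartialHomeomorph M ℂ} {z : ℂ}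
    (hz : z ∈ φ.target) (h : φ.symm z ∈ U) : ∀ᶠ w in 𝓝 z, w ∈ φ.target ∧ φ.symm w ∈ U :=
  inter_mem (φ.open_target.mem_nhds hz) ((φ.continuousAt_symm hz).preimage_mem_nhds (hU.mem_nhds h))

theorem IsSolution.solvesOn {G : M → OnePoint ℂ} {Q : HolomorphicTwoDifferential M}
    (hF : IsSolution G Q F) : SolvesOn (psiCoeff G Q) (IsRegularAt G) F := by
  intro p U hU hp φ hφ hpφ
  obtain ⟨D, hD, hreg⟩ := hF p φ hφ hpφ
  refine ⟨D, fun i j => ?_, fun h => ?_⟩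
  · have hz := φ.map_source hpφ
    have hsymm : φ.symm (φ p.proj) = p.proj := φ.left_inv hpφ
    have hself : p.lift U (φ.symm (φ p.proj)) = p := by rw [hsymm, lift_self hU hp]
    have hev := eventually_symm_mem hU.isOpen hz (by rwa [hsymm])
    have ht : Tendsto (fun z => p.lift U (φ.symm z)) (𝓝[≠] (φ p.proj)) (𝓝[≠] p) := by
      refine tendsto_nhdsWithin_iff.2 ⟨?_, ?_⟩
      · have h1 : ContinuousAt (p.lift U) (φ.symm (φ p.proj)) := by
          rw [hsymm]; exact continuousAt_lift hasDisks hU hp hp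
        have h2 := ContinuousAt.comp (f := φ.symm) h1 (φ.continuousAt_symm hz)
        have h3 : Tendsto (fun z => p.lift U (φ.symm z)) (𝓝 (φ p.proj)) (𝓝 p) := by
          have := h2.tendsto
          rwa [Function.comp_apply, hself] at this
        exact h3.mono_left nhdsWithin_le_nhds
      · filter_upwards [nhdsWithin_le_nhds hev, self_mem_nhdsWithin] with z hz hne heq
        refine hne ?_
        have : (p.lift U (φ.symm z)).proj = p.proj := congrArg _ heq
        rw [lift_proj hU hp hz.2] at this
        rw [mem_singleton_iff, ← this, φ.right_inv hz.1]
    rw [hasDerivAt_iff_tendsto_slope]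
    refine ((hD i j).comp ht).congr' ?_
    filter_upwards [nhdsWithin_le_nhds hev] with z hz
    simp only [Function.comp_apply, slope_def_field]
    rw [lift_proj hU hp hz.2, φ.right_inv hz.1, hself]
  · have := hreg h
    rw [← this, Matrix.mul_assoc, ← Matrix.SpecialLinearGroup.coe_mul, inv_mul_cancel,
      Matrix.SpecialLinearGroup.coe_one, Matrix.mul_one]

theorem SolvesOn.comp_coveringTransformation (hF : SolvesOn A S F) (τ : PiOne o) :
    SolvesOn A S fun p => F (coveringTransformation τ p) := by
  intro p U hU hp φ hφ hpφ
  obtain ⟨D, hD, hS⟩ := hF (coveringTransformation τ p) U hU hp φ hφ hpφ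
  refine ⟨D, fun i j => (hD i j).congr_of_eventuallyEq ?_, hS⟩
  have hsymm : φ.symm (φ p.proj) = p.proj := φ.left_inv hpφ
  filter_upwards [eventually_symm_mem hU.isOpen (φ.map_source hpφ) (hsymm.symm ▸ hp)] with z hz
  rw [coveringTransformation_lift hU hp hz.2]

/-- A constant gauge change: `(σ⁻¹ H)' = σ⁻¹ A H = A' σ⁻¹ H`. -/
theorem SolvesOn.inv_mul (hH : SolvesOn A S H) (σ : SL(2, ℂ))
    (hσ : ∀ φ z, S' φ z → S φ z ∧ A φ z * σ = (σ : Matrix (Fin 2) (Fin 2) ℂ) * A' φ z) :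
    SolvesOn A' S' fun p => σ⁻¹ * H p := by
  intro p U hU hp φ hφ hpφ
  obtain ⟨D, hD, hS⟩ := hH p U hU hp φ hφ hpφ
  refine ⟨((σ⁻¹ : SL(2, ℂ)) : Matrix (Fin 2) (Fin 2) ℂ) * D, fun i j => ?_, fun h => ?_⟩
  · simp only [Matrix.SpecialLinearGroup.coe_mul, Matrix.mul_apply]
    exact HasDerivAt.fun_sum fun k _ => (hD k j).const_mul _
  · obtain ⟨h1, h2⟩ := hσ _ _ h
    have h3 : ((σ⁻¹ : SL(2, ℂ)) : Matrix (Fin 2) (Fin 2) ℂ) * σ = 1 := by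
      rw [← Matrix.SpecialLinearGroup.coe_mul, inv_mul_cancel, Matrix.SpecialLinearGroup.coe_one]
    have h4 : (σ : Matrix (Fin 2) (Fin 2) ℂ) * ((σ⁻¹ : SL(2, ℂ)) : Matrix (Fin 2) (Fin 2) ℂ) = 1 := by
      rw [← Matrix.SpecialLinearGroup.coe_mul, mul_inv_cancel, Matrix.SpecialLinearGroup.coe_one]
    have h5 : A φ (φ p.proj) = σ * A' φ (φ p.proj) * ((σ⁻¹ : SL(2, ℂ)) : Matrix (Fin 2) (Fin 2) ℂ) := by
      rw [← h2, Matrix.mul_assoc, h4, Matrix.mul_one]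
    rw [hS h1, h5, Matrix.SpecialLinearGroup.coe_mul]
    simp only [← Matrix.mul_assoc]
    rw [h3, Matrix.one_mul]

/-- The derivative of `f⁻¹ h` for two solutions `f`, `h` of a differential equation. -/
theorem adjugate_mul_eq_zero {a f h : Matrix (Fin 2) (Fin 2) ℂ} (ha : a.trace = 0) :
    Matrix.adjugate (a * f) * h + Matrix.adjugate f * (a * h) = 0 := by
  rw [Matrix.trace_fin_two] at ha
  have h1 : a.adjugate = -a := by
    ext i j
    fin_cases i <;> fin_cases j <;> simp [Matrix.adjugate_fin_two]
    · linear_combination ha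
    · linear_combination ha
  rw [Matrix.adjugate_mul_distrib, h1, Matrix.mul_neg, Matrix.neg_mul, Matrix.mul_assoc,
    neg_add_cancel]

/-- In `SL₂` the inverse is the adjugate, whose entries are linear in those of the matrix, so the
product rule suffices. -/
theorem HasDerivAt.adjugate_mul {f h : ℂ → SL(2, ℂ)} {D E : Matrix (Fin 2) (Fin 2) ℂ} {z : ℂ}
    (hf : ∀ i j, HasDerivAt (fun w => f w i j) (D i j) z)
    (hh : ∀ i j, HasDerivAt (fun w => h w i j) (E i j) z) (i j : Fin 2) :
    HasDerivAt (fun w => ((f w)⁻¹ * h w) i j)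
      ((Matrix.adjugate D * (h z : Matrix (Fin 2) (Fin 2) ℂ) +
        Matrix.adjugate (f z : Matrix (Fin 2) (Fin 2) ℂ) * E) i j) z := by
  simp only [Matrix.SpecialLinearGroup.coe_mul, Matrix.SpecialLinearGroup.coe_inv,
    Matrix.add_apply, Matrix.mul_apply, ← Finset.sum_add_distrib]
  refine HasDerivAt.fun_sum fun k _ => HasDerivAt.fun_mul ?_ (hh k j)
  simp only [Matrix.adjugate_fin_two]
  fin_cases i <;> fin_cases k <;> simp
  · exact hf 1 1
  · exact (hf 0 1).neg
  · exact (hf 1 0).neg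
  · exact hf 0 0

/-- Two solutions differ by a constant right factor. -/
theorem SolvesOn.exists_eq_mul (hF : SolvesOn A S F) (hH : SolvesOn A S H)
    (hA : ∀ φ z, (A φ z).trace = 0)
    (hS : ∀ φ ∈ atlas ℂ M, ∀ z ∈ φ.target, ∃ᶠ w in 𝓝[≠] z, S φ w) :
    ∃ C, ∀ p, H p = F p * C := by
  let K : UniversalCover o → SL(2, ℂ) := fun p => (F p)⁻¹ * H p
  suffices h : ∀ p : UniversalCover o, ∃ U ∈ 𝓝 p.proj, ∀ q ∈ p.sheet U, K q = K p by
    refine ⟨K ⟨o, .mk (Path.refl o)⟩, fun p => ?_⟩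
    rw [← eq_of_locally_eq K h p]
    simp [K]
  intro p
  let φ := chartAt ℂ p.proj
  have hφ : φ ∈ atlas ℂ M := chart_mem_atlas ℂ p.proj
  have hps : p.proj ∈ φ.source := mem_chart_source ℂ p.proj
  obtain ⟨r, hr, hb⟩ := Metric.mem_nhds_iff.1 (φ.open_target.mem_nhds (φ.map_source hps))
  set B := Metric.ball (φ p.proj) r with hB
  let U := φ.symm '' B
  have hU : IsDisk U := φ.isDisk_image_ball hr hb
  have hcB : φ p.proj ∈ B := Metric.mem_ball_self hr
  have hpU : p.proj ∈ U := ⟨φ p.proj, hcB, φ.left_inv hps⟩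
  have hBo : IsOpen B := Metric.isOpen_ball
  have hsol : ∀ {J : UniversalCover o → SL(2, ℂ)}, SolvesOn A S J → ∀ z ∈ B,
      ∃ D : Matrix (Fin 2) (Fin 2) ℂ,
        (∀ i j, HasDerivAt (fun w => J (p.lift U (φ.symm w)) i j) (D i j) z) ∧
        (S φ z → D = A φ z * J (p.lift U (φ.symm z))) := by
    intro J hJ z hz
    have hzU : φ.symm z ∈ U := mem_image_of_mem _ hz
    have hproj : (p.lift U (φ.symm z)).proj = φ.symm z := lift_proj hU hpU hzU
    obtain ⟨D, hD, hDS⟩ := hJ (p.lift U (φ.symm z)) U hU (by rwa [hproj]) φ hφ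
      (by rw [hproj]; exact φ.map_target (hb hz))
    rw [hproj, φ.right_inv (hb hz)] at hD hDS
    refine ⟨D, fun i j => (hD i j).congr_of_eventuallyEq ?_, hDS⟩
    filter_upwards [hBo.mem_nhds hz] with w hw
    rw [lift_lift hU hpU hzU (mem_image_of_mem _ hw)]
  have hK : ∀ z ∈ B, ∃ E : Matrix (Fin 2) (Fin 2) ℂ,
      (∀ i j, HasDerivAt (fun w => K (p.lift U (φ.symm w)) i j) (E i j) z) ∧ (S φ z → E = 0) := by
    intro z hz
    obtain ⟨D, hD, hDS⟩ := hsol hF z hz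
    obtain ⟨D', hD', hDS'⟩ := hsol hH z hz
    refine ⟨_, HasDerivAt.adjugate_mul hD hD', fun h => ?_⟩
    rw [hDS h, hDS' h, adjugate_mul_eq_zero (hA φ z)]
  refine ⟨U, hU.isOpen.mem_nhds hpU, fun q hq => ?_⟩
  obtain ⟨hqU, hq⟩ := eq_lift_of_mem_sheet hU hq
  obtain ⟨z, hz, hqz⟩ := hqU
  have hpp : p = p.lift U (φ.symm (φ p.proj)) := by
    rw [φ.left_inv hps, lift_self hU hpU]
  have hq' : q = p.lift U (φ.symm z) := by rw [hqz, ← hq]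
  rw [hq']
  conv_rhs => rw [hpp]
  ext i j
  let k : ℂ → ℂ := fun w => K (p.lift U (φ.symm w)) i j
  have hkd : DifferentiableOn ℂ k B := fun w hw => by
    obtain ⟨E, hE, -⟩ := hK w hw
    exact (hE i j).differentiableAt.differentiableWithinAt
  refine hBo.is_const_of_deriv_eq_zero (f := k) (convex_ball _ _).isPreconnected hkd ?_ hz hcB
  intro w hw
  -- A derivative nonzero at `w` would stay nonzero nearby by continuity, but it vanishes at the
  -- points of `S`, which accumulate at `w`.
  by_contra hne
  have hcont := ((hkd.deriv hBo).differentiableAt (hBo.mem_nhds hw)).continuousAt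
  refine hS φ hφ w (hb hw) ?_
  filter_upwards [nhdsWithin_le_nhds (hcont.eventually_ne hne),
    nhdsWithin_le_nhds (hBo.mem_nhds hw)] with t ht htB htS
  obtain ⟨E, hE, hES⟩ := hK t htB
  refine ht ?_
  rw [(hE i j).deriv, hES htS]
  rfl

omit [ChartedSpace ℂ M] in
theorem coveringTransformation_mul (τ τ' : PiOne o) (p : UniversalCover o) :
    coveringTransformation (τ * τ') p =
      coveringTransformation τ (coveringTransformation τ' p) := by
  simp only [coveringTransformation, ← Path.Homotopic.Quotient.trans_assoc']
  rfl

theorem SolvesOn.existsUnique_representation (hF : SolvesOn A S F)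
    (hA : ∀ φ z, (A φ z).trace = 0)
    (hS : ∀ φ ∈ atlas ℂ M, ∀ z ∈ φ.target, ∃ᶠ w in 𝓝[≠] z, S φ w) :
    ∃! ρ : PiOne o →* SL(2, ℂ), IsAssociatedRepresentation F ρ := by
  choose C hC using fun τ => hF.exists_eq_mul (hF.comp_coveringTransformation τ) hA hS
  let p : UniversalCover o := ⟨o, .mk (Path.refl o)⟩
  -- The constants multiply in reverse order, so it is `τ ↦ (C τ)⁻¹` that is a homomorphism.
  have hmul : ∀ τ τ', C (τ * τ') = C τ' * C τ := by
    intro τ τ'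
    have := hC (τ * τ') p
    rwa [coveringTransformation_mul, hC τ, hC τ', mul_assoc, mul_right_inj, eq_comm] at this
  refine ⟨MonoidHom.mk' (fun τ => (C τ)⁻¹) fun τ τ' => by rw [hmul, mul_inv_rev],
    fun τ q => by simp [hC τ q], fun ρ hρ => ?_⟩
  ext1 τ
  have := (hρ τ p).symm.trans (hC τ p)
  rw [mul_right_inj] at this
  rw [MonoidHom.mk'_apply, ← this, inv_inv]

end Solutions

/-! ### Reflections -/

section Reflections

variable {M : Type*} [TopologicalSpace M] [ChartedSpace ℂ M] {o : M}

open UniversalCover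

/-- The function is the composite of `conj ∘ f ∘ conj` and `conj ∘ w`, both complex differentiable
at the relevant points. -/
theorem HasDerivAt.conj_comp {f w : ℂ → ℂ} {f' d z : ℂ} (hf : HasDerivAt f f' (w z))
    (hw : HasDerivAt (fun t => conj (w t)) d z) :
    HasDerivAt (fun t => conj (f (w t))) (conj f' * d) z := by
  have h1 : HasDerivAt (conj ∘ f ∘ conj) (conj f') (conj (w z)) := by
    have := HasDerivAt.conj_conj hf
    simpa using this
  have h2 := HasDerivAt.comp z (h := fun t => conj (w t)) h1 hw
  refine h2.congr_of_eventuallyEq (.of_forall fun t => ?_)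
  simp

/-- The complex conjugate of `G ∘ μ`. -/
def reflectedMap (μ : C(M, M)) (G : M → OnePoint ℂ) (x : M) : OnePoint ℂ := (G (μ x)).map conj

omit [ChartedSpace ℂ M] in
theorem eventually_reflected {μ : C(M, M)} {φ ψ : OpenPartialHomeomorph M ℂ} {z : ℂ}
    (hz : z ∈ φ.target) (hψ : μ (φ.symm z) ∈ ψ.source) :
    ∀ᶠ t in 𝓝 z, t ∈ φ.target ∧ μ (φ.symm t) ∈ ψ.source :=
  eventually_symm_mem (ψ.open_source.preimage μ.continuous) hz hψ

omit [ChartedSpace ℂ M] in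
theorem continuousAt_reflected {μ : C(M, M)} {φ ψ : OpenPartialHomeomorph M ℂ} {z : ℂ}
    (hz : z ∈ φ.target) (hψ : μ (φ.symm z) ∈ ψ.source) :
    ContinuousAt (fun t => ψ (μ (φ.symm t))) z :=
  ContinuousAt.comp (g := ψ) (ψ.continuousAt hψ)
    (ContinuousAt.comp (g := μ) μ.continuous.continuousAt (φ.continuousAt_symm hz))

theorem IsSphereHolomorphic.reflectedMap {G : M → OnePoint ℂ} (hG : IsSphereHolomorphic G)
    {μ : C(M, M)} (hμ : IsReflection μ) : IsSphereHolomorphic (reflectedMap μ G) := by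
  intro φ hφ z hz
  let ψ := chartAt ℂ (μ (φ.symm z))
  have hψ : ψ ∈ atlas ℂ M := chart_mem_atlas ℂ _
  have hs : μ (φ.symm z) ∈ ψ.source := mem_chart_source ℂ _
  obtain ⟨u, v, hu, hv, huv⟩ := hG ψ hψ (ψ (μ (φ.symm z))) (ψ.map_source hs)
  have hev := eventually_reflected hz hs
  have hcont := continuousAt_reflected hz hs
  have han : ∀ f : ℂ → ℂ, AnalyticAt ℂ f (ψ (μ (φ.symm z))) →
      AnalyticAt ℂ (fun t => conj (f (ψ (μ (φ.symm t))))) z := by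
    intro f hf
    refine Complex.analyticAt_iff_eventually_differentiableAt.2 ?_
    filter_upwards [hev, hcont.eventually hf.eventually_analyticAt] with t ht hft
    exact (HasDerivAt.conj_comp (w := fun t => ψ (μ (φ.symm t))) hft.differentiableAt.hasDerivAt
      (hμ.antiholomorphic φ hφ ψ hψ t ht.1 ht.2).hasDerivAt).differentiableAt
  refine ⟨_, _, han u hu, han v hv, ?_⟩
  filter_upwards [hev, hcont.eventually huv] with t ht hft
  refine ⟨by simpa using hft.1, ?_⟩
  rw [_root_.reflectedMap, ← map_conj_spherePoint, ← hft.2, ψ.left_inv ht.2]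

theorem sphereVal_map_conj (c : OnePoint ℂ) : sphereVal (c.map conj) = conj (sphereVal c) := by
  induction c using OnePoint.rec <;> simp [sphereVal]

theorem map_conj_ne_infty {c : OnePoint ℂ} (h : c.map conj ≠ OnePoint.infty) :
    c ≠ OnePoint.infty := by
  rintro rfl
  exact h rfl

theorem map_conj_map_conj (c : OnePoint ℂ) : (c.map conj).map conj = c := by
  induction c using OnePoint.rec <;> simp

/-- The derivative of the reflected map in coordinates. -/
theorem coordDeriv_reflectedMap {G : M → OnePoint ℂ} (hG : IsMeromorphicFunction G) {μ : C(M, M)}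
    (hμ : IsReflection μ) {φ ψ : OpenPartialHomeomorph M ℂ} (hφ : φ ∈ atlas ℂ M)
    (hψ : ψ ∈ atlas ℂ M) {z : ℂ} (hz : z ∈ φ.target) (hs : μ (φ.symm z) ∈ ψ.source)
    (hreg : IsRegularAt (reflectedMap μ G) φ z) :
    IsRegularAt G ψ (ψ (μ (φ.symm z))) ∧ coordDeriv (reflectedMap μ G) φ z =
      conj (coordDeriv G ψ (ψ (μ (φ.symm z)))) * deriv (fun w => conj (ψ (μ (φ.symm w)))) z := by
  have hfin : G (ψ.symm (ψ (μ (φ.symm z)))) ≠ OnePoint.infty := by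
    rw [ψ.left_inv hs]
    exact map_conj_ne_infty hreg.1
  have hd : HasDerivAt (fun t => conj (sphereVal (G (ψ.symm (ψ (μ (φ.symm t)))))))
      (conj (coordDeriv G ψ (ψ (μ (φ.symm z)))) *
        deriv (fun w => conj (ψ (μ (φ.symm w)))) z) z :=
    HasDerivAt.conj_comp (f := fun w => sphereVal (G (ψ.symm w))) (w := fun t => ψ (μ (φ.symm t)))
      (hG.holomorphic ψ hψ _ (ψ.map_source hs) hfin).hasDerivAt
      (hμ.antiholomorphic φ hφ ψ hψ z hz hs).hasDerivAt
  have he : (fun t => sphereVal (reflectedMap μ G (φ.symm t))) =ᶠ[𝓝 z]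
      fun t => conj (sphereVal (G (ψ.symm (ψ (μ (φ.symm t)))))) := by
    filter_upwards [eventually_reflected hz hs] with t ht
    rw [reflectedMap, sphereVal_map_conj, ψ.left_inv ht.2]
  have key : coordDeriv (reflectedMap μ G) φ z = _ := (hd.congr_of_eventuallyEq he).deriv
  refine ⟨⟨hfin, fun h0 => hreg.2 ?_⟩, key⟩
  rw [key, h0, map_zero, zero_mul]

/-- The reflected solution solves the equation for the reflected map. -/
theorem SolvesOn.reflected {G : M → OnePoint ℂ} (hG : IsMeromorphicFunction G)
    {Q : HolomorphicTwoDifferential M} {μ : C(M, M)} (hμ : IsReflection μ)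
    (hinv : IsInvariantPair μ G Q) (P : Path o (μ o)) {F : UniversalCover o → SL(2, ℂ)}
    (hF : SolvesOn (psiCoeff G Q) (IsRegularAt G) F) :
    SolvesOn (psiCoeff (reflectedMap μ G) Q) (IsRegularAt (reflectedMap μ G)) fun p =>
      Matrix.SpecialLinearGroup.map (starRingEnd ℂ) (F (reflectionLift μ P p)) := by
  intro p U hU hp φ hφ hpφ
  have hz : φ p.proj ∈ φ.target := φ.map_source hpφ
  have hsymm : φ.symm (φ p.proj) = p.proj := φ.left_inv hpφ
  let ψ := chartAt ℂ (μ p.proj)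
  have hψ : ψ ∈ atlas ℂ M := chart_mem_atlas ℂ _
  have hs' : μ p.proj ∈ ψ.source := mem_chart_source ℂ _
  have hs : μ (φ.symm (φ p.proj)) ∈ ψ.source := by rwa [hsymm]
  -- `U` need not map into the domain of one chart. On a smaller disk `W`, mapped by `μ` into a disk
  -- `V` in the domain of `ψ`, the lift over `U` is carried to the lift over `V`.
  obtain ⟨V, hVs, hmV, hV⟩ := hasDisks (μ p.proj) _ (ψ.open_source.mem_nhds hs')
  obtain ⟨W, hWs, hpW, hW⟩ := hasDisks p.proj (U ∩ μ ⁻¹' V)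
    (inter_mem (hU.isOpen.mem_nhds hp) (μ.continuous.continuousAt.preimage_mem_nhds
      (hV.isOpen.mem_nhds hmV)))
  obtain ⟨D, hD, hDS⟩ := hF (reflectionLift μ P p) V hV hmV ψ hψ hs'
  have hanti := hμ.antiholomorphic φ hφ ψ hψ _ hz hs
  set d := deriv (fun w => conj (ψ (μ (φ.symm w)))) (φ p.proj) with hd
  refine ⟨d • D.map conj, fun i j => ?_, fun hreg => ?_⟩
  · have h1 : HasDerivAt (fun t => conj (F ((reflectionLift μ P p).lift V
        (ψ.symm (ψ (μ (φ.symm t))))) i j)) (conj (D i j) * d) (φ p.proj) := by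
      refine HasDerivAt.conj_comp (f := fun w => F ((reflectionLift μ P p).lift V (ψ.symm w)) i j)
        (w := fun t => ψ (μ (φ.symm t))) ?_ hanti.hasDerivAt
      rw [hsymm]
      exact hD i j
    rw [Matrix.smul_apply, Matrix.map_apply, smul_eq_mul, mul_comm]
    refine h1.congr_of_eventuallyEq ?_
    filter_upwards [eventually_symm_mem hW.isOpen hz (by rwa [hsymm])] with t ht
    rw [← lift_mono hU hW (fun y hy => (hWs hy).1) hpW ht.2,
      reflectionLift_lift hW hV hpW ht.2 μ P fun y hy => (hWs hy).2,
      ψ.left_inv (hVs (hWs ht.2).2)]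
    rfl
  · obtain ⟨hregG, hder⟩ := coordDeriv_reflectedMap hG hμ hφ hψ hz hs hreg
    have hQ := hinv.differential φ hφ ψ hψ _ hz hs
    rw [← hd] at hder hQ
    have hne := hreg.2
    rw [hder] at hne
    have hd0 : d ≠ 0 := right_ne_zero_of_mul hne
    have hc0 := left_ne_zero_of_mul hne
    rw [hsymm] at hregG hder hQ hc0
    have hDe : D = psiCoeff G Q ψ (ψ (μ p.proj)) * F (reflectionLift μ P p) := hDS hregG
    have hmap : D.map conj = (psiCoeff G Q ψ (ψ (μ p.proj))).map conj *
        (Matrix.SpecialLinearGroup.map (starRingEnd ℂ) (F (reflectionLift μ P p)) :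
          Matrix (Fin 2) (Fin 2) ℂ) := by
      rw [hDe, Matrix.map_mul]
      rfl
    -- Invariance of `Q` gives a factor `d ^ 2` and the derivative of the reflected map a factor
    -- `d`; the quotient leaves the `d` that the chain rule for `F` supplies.
    have hpsi : d • (psiCoeff G Q ψ (ψ (μ p.proj))).map conj =
        psiCoeff (reflectedMap μ G) Q φ (φ p.proj) := by
      have hv : sphereVal (reflectedMap μ G (φ.symm (φ p.proj))) =
          conj (sphereVal (G (ψ.symm (ψ (μ p.proj))))) := by
        rw [reflectedMap, sphereVal_map_conj, hsymm, ψ.left_inv hs']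
      have hcoef : d * (conj (Q.coeff ψ (ψ (μ p.proj))) / conj (coordDeriv G ψ (ψ (μ p.proj)))) =
          Q.coeff φ (φ p.proj) / coordDeriv (reflectedMap μ G) φ (φ p.proj) := by
        rw [hder, ← hQ]
        field_simp
      rw [psiCoeff, psiCoeff, hv, ← hcoef]
      ext i j
      fin_cases i <;> fin_cases j <;> simp [mul_assoc]
    rw [hmap, ← Matrix.smul_mul, hpsi]

/-- Near the point with coordinate `z`, the map `G` has neither poles nor critical points. -/
def IsRegularNear (G : M → OnePoint ℂ) (φ : OpenPartialHomeomorph M ℂ) (z : ℂ) : Prop :=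
  ∀ᶠ t in 𝓝 z, t ∈ φ.target ∧ IsRegularAt G φ t ∧
    DifferentiableAt ℂ (fun s => sphereVal (G (φ.symm s))) t

theorem IsSphereHolomorphic.eventually_isRegularNear [ConnectedSpace M] {G : M → OnePoint ℂ}
    (hG : IsSphereHolomorphic G) (hne : ¬ ∃ c, ∀ x, G x = c) {φ : OpenPartialHomeomorph M ℂ}
    (hφ : φ ∈ atlas ℂ M) {z : ℂ} (hz : z ∈ φ.target) :
    ∀ᶠ w in 𝓝[≠] z, IsRegularNear G φ w := by
  filter_upwards [eventually_eventually_nhdsWithin.2 (hG.eventually_isRegularAt hne hφ hz),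
    self_mem_nhdsWithin] with w hw hwz
  rwa [isOpen_compl_singleton.nhdsWithin_eq hwz] at hw

/-! ### Möbius transforms of `G` and invariance of the spherical metric -/

theorem coe_sphereVal {c : OnePoint ℂ} (h : c ≠ OnePoint.infty) :
    ((sphereVal c : ℂ) : OnePoint ℂ) = c := by
  induction c using OnePoint.rec with
  | infty => exact (h rfl).elim
  | coe c => rfl

theorem sphereVal_smul {σ : SL(2, ℂ)} {c e : OnePoint ℂ} (hc : c ≠ OnePoint.infty)
    (he : e ≠ OnePoint.infty) (h : e = (σ : GL (Fin 2) ℂ) • c) :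
    sphereVal e * (σ 1 0 * sphereVal c + σ 1 1) = σ 0 0 * sphereVal c + σ 0 1 := by
  rw [← coe_sphereVal hc, ← coe_sphereVal he, ← spherePoint_one, ← spherePoint_one,
    smul_spherePoint σ (by simp), spherePoint_eq_iff (by simp)
    (SL2_mulVec_ne_zero σ (by simp))] at h
  linear_combination h

/-- The matrix `Ψ` of a Möbius transform of `G`. -/
theorem psiCoeff_smul {G G' : M → OnePoint ℂ} {σ : SL(2, ℂ)}
    (h : ∀ x, G' x = (σ : GL (Fin 2) ℂ) • G x) (Q : HolomorphicTwoDifferential M)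
    {φ : OpenPartialHomeomorph M ℂ} {z : ℂ} (hG : IsRegularNear G φ z)
    (hG' : IsRegularNear G' φ z) :
    psiCoeff G' Q φ z * σ = (σ : Matrix (Fin 2) (Fin 2) ℂ) * psiCoeff G Q φ z := by
  have hrel : ∀ᶠ t in 𝓝 z, sphereVal (G' (φ.symm t)) *
      (σ 1 0 * sphereVal (G (φ.symm t)) + σ 1 1) = σ 0 0 * sphereVal (G (φ.symm t)) + σ 0 1 := by
    filter_upwards [hG, hG'] with t h1 h2
    exact sphereVal_smul h1.2.1.1 h2.2.1.1 (h _)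
  obtain ⟨-, hr, hd⟩ := hG.self_of_nhds
  obtain ⟨-, hr', hd'⟩ := hG'.self_of_nhds
  have e1 := hd'.hasDerivAt.fun_mul ((hd.hasDerivAt.const_mul (σ 1 0)).add_const (σ 1 1))
  have e2 := (hd.hasDerivAt.const_mul (σ 0 0)).add_const (σ 0 1)
  have hder := e1.unique (e2.congr_of_eventuallyEq hrel)
  have h0 := hrel.self_of_nhds
  have hdet := σ.det_coe
  rw [Matrix.det_fin_two] at hdet
  have hg0 := hr.2
  have hg0' := hr'.2
  change coordDeriv G' φ z * _ + _ * (_ * coordDeriv G φ z) = _ * coordDeriv G φ z at hder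
  rw [psiCoeff, psiCoeff]
  generalize coordDeriv G φ z = g1 at *
  generalize coordDeriv G' φ z = k1 at *
  generalize sphereVal (G (φ.symm z)) = g at *
  generalize sphereVal (G' (φ.symm z)) = k at *
  generalize Q.coeff φ z = q at *
  have ht : k1 * (σ 1 0 * g + σ 1 1) ^ 2 = g1 := by
    linear_combination (σ 1 0 * g + σ 1 1) * hder - σ 1 0 * g1 * h0 + g1 * hdet
  have ht0 : (σ 1 0 * g + σ 1 1) ≠ 0 := by
    intro h
    rw [h] at ht
    exact hg0 (by rw [← ht]; ring)
  have hq : q / k1 = q / g1 * (σ 1 0 * g + σ 1 1) ^ 2 := by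
    rw [← ht]
    field_simp
  rw [hq]
  -- Up to the factor `q / g1`, `Ψ` is the column `(g, 1)` times the row `(1, -g)`. Here `σ` sends
  -- the column `(g, 1)` to `(n, t)`, and `h1`, `h2` say that the row `(t, -n)` times `σ` is `(1,
  -- -g)`.
  set t := σ 1 0 * g + σ 1 1 with htdef
  set n := σ 0 0 * g + σ 0 1 with hndef
  have h1 : t * σ 0 0 - n * σ 1 0 = 1 := by linear_combination hdet
  have h2 : t * σ 0 1 - n * σ 1 1 = -g := by linear_combination -g * hdet
  ext i j
  fin_cases i <;> fin_cases j <;> simp [Matrix.mul_apply, Fin.sum_univ_two]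
  · linear_combination q / g1 * ((t * σ 0 0 - σ 1 0 * (k * t + n)) * h0 + n * h1)
  · linear_combination q / g1 * ((t * σ 0 1 - σ 1 1 * (k * t + n)) * h0 + n * h2)
  · linear_combination q / g1 * (-t * σ 1 0 * h0 + t * h1)
  · linear_combination q / g1 * (-t * σ 1 1 * h0 + t * h2)

/-- The invariance of the metric and of `Q` makes the spherical metrics of `G` and of its reflected
map agree. -/
theorem norm_coordDeriv_reflectedMap {G : M → OnePoint ℂ} (hG : IsMeromorphicFunction G)
    {Q : HolomorphicTwoDifferential M} {μ : C(M, M)} (hμ : IsReflection μ)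
    (hinv : IsInvariantPair μ G Q) {m : ConformalMetric M} (hm : IsSharpMetric G Q m)
    {φ : OpenPartialHomeomorph M ℂ} (hφ : φ ∈ atlas ℂ M) {z : ℂ} (hz : z ∈ φ.target)
    (hreg : IsRegularAt G φ z) (hreg' : IsRegularAt (reflectedMap μ G) φ z) :
    ‖coordDeriv G φ z‖ * (1 + ‖sphereVal (reflectedMap μ G (φ.symm z))‖ ^ 2) =
      ‖coordDeriv (reflectedMap μ G) φ z‖ * (1 + ‖sphereVal (G (φ.symm z))‖ ^ 2) := by
  let ψ := chartAt ℂ (μ (φ.symm z))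
  have hψ : ψ ∈ atlas ℂ M := chart_mem_atlas ℂ _
  have hs : μ (φ.symm z) ∈ ψ.source := mem_chart_source ℂ _
  obtain ⟨hregψ, hder⟩ := coordDeriv_reflectedMap hG hμ hφ hψ hz hs hreg'
  have hmet := hinv.metric m hm φ hφ ψ hψ z hz hs
  have hpos := m.pos φ hφ z hz
  rw [hm φ hφ z hz hreg] at hmet hpos
  rw [hm ψ hψ _ (ψ.map_source hs) hregψ] at hmet
  have hQ := congrArg norm (hinv.differential φ hφ ψ hψ z hz hs)
  have hv : ‖sphereVal (reflectedMap μ G (φ.symm z))‖ =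
      ‖sphereVal (G (ψ.symm (ψ (μ (φ.symm z)))))‖ := by
    rw [reflectedMap, sphereVal_map_conj, ψ.left_inv hs, RCLike.norm_conj]
  have hd := congrArg norm hder
  have hk0 := norm_ne_zero_iff.2 hreg'.2
  have hg0 := norm_ne_zero_iff.2 hreg.2
  have ha0 := norm_ne_zero_iff.2 hregψ.2
  rw [hv]
  simp only [norm_mul, norm_pow, RCLike.norm_conj, norm_div] at hQ hd hmet hpos
  rw [hd] at hk0 ⊢
  have p1 := norm_nonneg (deriv (fun w => conj (ψ (μ (φ.symm w)))) z)
  have p2 := norm_nonneg (coordDeriv G φ z)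
  have p3 := norm_nonneg (coordDeriv G ψ (ψ (μ (φ.symm z))))
  generalize ‖deriv (fun w => conj (ψ (μ (φ.symm w)))) z‖ = d at *
  generalize ‖coordDeriv G φ z‖ = g1 at *
  generalize ‖coordDeriv G ψ (ψ (μ (φ.symm z)))‖ = a at *
  generalize ‖Q.coeff φ z‖ = q at *
  generalize ‖Q.coeff ψ (ψ (μ (φ.symm z)))‖ = q' at *
  -- Positivity of the metric prevents `Q` from vanishing at a regular point of `G`, so `Q` can be
  -- cancelled from the metric identity.
  have hq0 : q ≠ 0 := by
    rintro rfl
    simp at hpos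
  refine (sq_eq_sq₀ (by positivity) (by positivity)).1 ?_
  refine mul_left_cancel₀ (pow_ne_zero 2 hq0) ?_
  field_simp at hmet
  rw [← hQ] at hmet ⊢
  linear_combination d ^ 2 * hmet

/-! ### Existence of reflection matrices -/

theorem reflectedMap_not_const {G : M → OnePoint ℂ} (hne : ¬ ∃ c, ∀ x, G x = c) {μ : C(M, M)}
    (hμ : IsReflection μ) : ¬ ∃ c, ∀ x, reflectedMap μ G x = c := by
  rintro ⟨c, hc⟩
  refine hne ⟨c.map conj, fun x => ?_⟩
  rw [← hc (μ x), reflectedMap, hμ.involutive x, map_conj_map_conj]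

theorem IsReflection.exists_smul_eq [ConnectedSpace M] {G : M → OnePoint ℂ}
    (hG : IsMeromorphicFunction G)
    {Q : HolomorphicTwoDifferential M} {μ : C(M, M)} (hμ : IsReflection μ)
    (hadm : IsAdmissible G Q) (hinv : IsInvariantPair μ G Q) :
    ∃ σ : SL(2, ℂ), ∀ x, reflectedMap μ G x = (σ : GL (Fin 2) ℂ) • G x := by
  obtain ⟨⟨φ, hφ, z₀, hz₀, hreg₀⟩, m, hm⟩ := hadm
  have hS := hG.isSphereHolomorphic
  have hS' := hS.reflectedMap hμ
  obtain ⟨z, h1, h2⟩ := ((hS.eventually_isRegularNear hreg₀.not_const hφ hz₀).and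
    (hS'.eventually_isRegularNear (reflectedMap_not_const hreg₀.not_const hμ) hφ hz₀)).exists
  obtain ⟨r, hr, hb⟩ := Metric.eventually_nhds_iff_ball.1 (h1.and h2)
  obtain ⟨σ, hσ⟩ := exists_smul_eq_of_metric_eq (g := fun t => sphereVal (G (φ.symm t)))
    (h := fun t => sphereVal (reflectedMap μ G (φ.symm t))) hr
    (fun t ht => (hb t ht).1.2.2.differentiableWithinAt)
    (fun t ht => (hb t ht).2.2.2.differentiableWithinAt) h1.self_of_nhds.2.1.2
    (fun t ht => norm_coordDeriv_reflectedMap hG hμ hinv hm hφ (hb t ht).1.1 (hb t ht).1.2.1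
      (hb t ht).2.2.1)
  refine ⟨σ, hS'.eq_of_frequently_eq (hS.smul σ) hφ h1.self_of_nhds.1
    (Eventually.frequently (Eventually.filter_mono nhdsWithin_le_nhds ?_))⟩
  filter_upwards [hσ, h1, h2] with t ht ht1 ht2
  rwa [coe_sphereVal ht1.2.1.1, coe_sphereVal ht2.2.1.1] at ht

theorem trace_psiCoeff (G : M → OnePoint ℂ) (Q : HolomorphicTwoDifferential M)
    (φ : OpenPartialHomeomorph M ℂ) (z : ℂ) : (psiCoeff G Q φ z).trace = 0 := by
  simp [psiCoeff, Matrix.trace_fin_two]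

/-- Every lift of a reflection has a reflection matrix. -/
theorem IsSolution.exists_isReflectionMatrix [ConnectedSpace M] {G : M → OnePoint ℂ}
    (hG : IsMeromorphicFunction G)
    {Q : HolomorphicTwoDifferential M} {μ : C(M, M)} (hμ : IsReflection μ)
    (hadm : IsAdmissible G Q) (hinv : IsInvariantPair μ G Q) (P : Path o (μ o))
    {F : UniversalCover o → SL(2, ℂ)} (hF : IsSolution G Q F) :
    ∃ ρ, IsReflectionMatrix G F μ P ρ := by
  obtain ⟨σ, hσ⟩ := hμ.exists_smul_eq hG hadm hinv
  obtain ⟨⟨φ, hφ, z₀, hz₀, hreg₀⟩, -⟩ := hadm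
  have hS := hG.isSphereHolomorphic
  -- Regularity is required on a neighbourhood because `psiCoeff_smul` differentiates the Möbius
  -- relation between the two maps.
  let S : OpenPartialHomeomorph M ℂ → ℂ → Prop := fun φ z =>
    IsRegularNear G φ z ∧ IsRegularNear (reflectedMap μ G) φ z
  have h1 : SolvesOn (psiCoeff G Q) S fun p =>
      σ⁻¹ * Matrix.SpecialLinearGroup.map (starRingEnd ℂ) (F (reflectionLift μ P p)) :=
    (hF.solvesOn.reflected hG hμ hinv P).inv_mul σ fun φ z h =>
      ⟨h.2.self_of_nhds.2.1, psiCoeff_smul hσ Q h.1 h.2⟩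
  have h2 : SolvesOn (psiCoeff G Q) S F := by
    simpa using hF.solvesOn.inv_mul (S' := S) (A' := psiCoeff G Q) 1 fun φ z h =>
      ⟨h.1.self_of_nhds.2.1, by simp⟩
  obtain ⟨C, hC⟩ := h2.exists_eq_mul h1 (trace_psiCoeff G Q) fun φ hφ z hz =>
    ((hS.eventually_isRegularNear hreg₀.not_const hφ hz).and
      ((hS.reflectedMap hμ).eventually_isRegularNear
        (reflectedMap_not_const hreg₀.not_const hμ) hφ hz)).frequently
  refine ⟨C⁻¹, σ, hσ, fun p => ?_⟩
  rw [inv_inv, mul_assoc, ← hC p, mul_inv_cancel_left]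

end Reflections

/-! ### Words in the reflections -/

section Words

/-- The matrix `e₃` is real, so the defining relation may be conjugated entrywise. -/
theorem map_conj_mem_SU11 {a : SL(2, ℂ)} (ha : a ∈ SU11) :
    Matrix.SpecialLinearGroup.map (starRingEnd ℂ) a ∈ SU11 := by
  have h : (a : Matrix (Fin 2) (Fin 2) ℂ) * !![1, 0; 0, -1] *
    (a : Matrix (Fin 2) (Fin 2) ℂ).conjTranspose = !![1, 0; 0, -1] := ha
  change (a : Matrix (Fin 2) (Fin 2) ℂ).map conj * !![1, 0; 0, -1] *
    ((a : Matrix (Fin 2) (Fin 2) ℂ).map conj).conjTranspose = !![1, 0; 0, -1]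
  have h2 := congrArg (fun m : Matrix (Fin 2) (Fin 2) ℂ => m.map conj) h
  simp only [Matrix.map_mul] at h2
  have he : (!![1, 0; 0, -1] : Matrix (Fin 2) (Fin 2) ℂ).map conj = !![1, 0; 0, -1] := by
    ext i j; fin_cases i <;> fin_cases j <;> simp
  rw [he] at h2
  convert h2 using 2
  ext i j
  rfl

theorem map_conj_map_conj_SL (a : SL(2, ℂ)) : Matrix.SpecialLinearGroup.map (starRingEnd ℂ)
    (Matrix.SpecialLinearGroup.map (starRingEnd ℂ) a) = a := by
  ext i j
  simp

theorem map_conj_smul (σ : SL(2, ℂ)) (c : OnePoint ℂ) :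
    ((σ : GL (Fin 2) ℂ) • c).map conj =
      ((Matrix.SpecialLinearGroup.map (starRingEnd ℂ) σ : SL(2, ℂ)) : GL (Fin 2) ℂ) • c.map conj := by
  rw [OnePoint.map_smul]
  congr 1
  ext i j
  rfl

theorem neg_one_mem_SU11 : (-1 : SL(2, ℂ)) ∈ SU11 := by
  change ((-1 : SL(2, ℂ)) : Matrix (Fin 2) (Fin 2) ℂ) * _ *
    ((-1 : SL(2, ℂ)) : Matrix (Fin 2) (Fin 2) ℂ).conjTranspose = _
  simp

variable {M : Type*} [TopologicalSpace M] {o : M}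

/-- Each lift exchanges `F` with its conjugate, so both parities are carried through the induction.
Prepending a letter multiplies `A` on the left by `σ` or its conjugate, and `B` on the right by
`ρ⁻¹` or its conjugate. The relation for `G` is carried along because it is what later determines
`A`. -/
theorem exists_mul_mul_of_word {N : ℕ} {μ : Fin N → C(M, M)} {P : ∀ j, Path o (μ j o)}
    {G : M → OnePoint ℂ} {F : UniversalCover o → SL(2, ℂ)} {ρ : Fin N → SL(2, ℂ)}
    (hρ : ∀ j, IsReflectionMatrix G F (μ j) (P j) (ρ j)) (hSU : ∀ j, ρ j ∈ SU11)
    (l : List (Fin N)) :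
    (Even l.length → ∃ A B : SL(2, ℂ), B ∈ SU11 ∧
      ∀ p, F ((l.map fun j => reflectionLift (μ j) (P j)).foldr (· ∘ ·) id p) = A * F p * B ∧
        G ((l.map fun j => reflectionLift (μ j) (P j)).foldr (· ∘ ·) id p).proj =
          (A : GL (Fin 2) ℂ) • G p.proj) ∧
    (¬ Even l.length → ∃ A B : SL(2, ℂ), B ∈ SU11 ∧
      ∀ p, Matrix.SpecialLinearGroup.map (starRingEnd ℂ)
          (F ((l.map fun j => reflectionLift (μ j) (P j)).foldr (· ∘ ·) id p)) = A * F p * B ∧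
        (G ((l.map fun j => reflectionLift (μ j) (P j)).foldr (· ∘ ·) id p).proj).map conj =
          (A : GL (Fin 2) ℂ) • G p.proj) := by
  induction l with
  | nil => exact ⟨fun _ => ⟨1, 1, SU11.one_mem, fun p => by simp⟩, fun h => by simp at h⟩
  | cons j l ih =>
    obtain ⟨σ, hσG, hσF⟩ := hρ j
    simp only [List.length_cons, List.map_cons, List.foldr_cons, Function.comp_apply,
      Nat.even_add_one, not_not]
    refine ⟨fun h => ?_, fun h => ?_⟩
    · obtain ⟨A, B, hB, hAB⟩ := ih.2 h
      refine ⟨Matrix.SpecialLinearGroup.map (starRingEnd ℂ) σ * A,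
        B * (Matrix.SpecialLinearGroup.map (starRingEnd ℂ) (ρ j))⁻¹,
        SU11.mul_mem hB (SU11.inv_mem (map_conj_mem_SU11 (hSU j))), fun p => ⟨?_, ?_⟩⟩
      · rw [← map_conj_map_conj_SL (F _), hσF, map_mul, map_mul, (hAB p).1, map_inv]
        simp only [mul_assoc]
      · rw [← map_conj_map_conj (G _), reflectionLift, hσG, map_conj_smul, (hAB p).2, smul_smul,
          map_mul]
    · obtain ⟨A, B, hB, hAB⟩ := ih.1 h
      refine ⟨σ * A, B * (ρ j)⁻¹, SU11.mul_mem hB (SU11.inv_mem (hSU j)), fun p => ⟨?_, ?_⟩⟩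
      · rw [hσF, (hAB p).1]
        simp only [mul_assoc]
      · rw [reflectionLift, hσG, (hAB p).2, smul_smul, map_mul]

/-- Only `±1` acts trivially on the values of a nonconstant map to the sphere. -/
theorem IsSphereHolomorphic.eq_one_or_neg_one_of_smul_eq [ChartedSpace ℂ M] [ConnectedSpace M]
    {G : M → OnePoint ℂ}
    (hG : IsSphereHolomorphic G) (hne : ¬ ∃ c, ∀ x, G x = c) {A : SL(2, ℂ)}
    (hA : ∀ x, G x = (A : GL (Fin 2) ℂ) • G x) : A = 1 ∨ A = -1 := by
  obtain ⟨x⟩ : Nonempty M := inferInstance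
  obtain ⟨z, hz⟩ := (hG.eventually_isRegularNear hne (chart_mem_atlas ℂ x)
    (mem_chart_target ℂ x)).exists
  set φ := chartAt ℂ x
  set g : ℂ → ℂ := fun t => sphereVal (G (φ.symm t)) with hg
  have hrel : ∀ᶠ t in 𝓝 z, g t * (A 1 0 * g t + A 1 1) = A 0 0 * g t + A 0 1 := by
    filter_upwards [hz] with t ht
    exact sphereVal_smul ht.2.1.1 ht.2.1.1 (hA _)
  -- Differentiate the quadratic fixed-point relation and cancel `g' ≠ 0`; one more differentiation
  -- gives `A 1 0 = 0`.
  have hrel' : ∀ᶠ t in 𝓝 z, 2 * A 1 0 * g t = A 0 0 - A 1 1 := by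
    filter_upwards [hz, hrel.eventually_nhds] with t ht htr
    have d : HasDerivAt g (deriv g t) t := ht.2.2.hasDerivAt
    have e1 := d.fun_mul ((d.const_mul (A 1 0)).add_const (A 1 1))
    have e2 := (d.const_mul (A 0 0)).add_const (A 0 1)
    have hder := e1.unique (e2.congr_of_eventuallyEq htr)
    have h0 : deriv g t ≠ 0 := ht.2.1.2
    refine mul_left_cancel₀ h0 ?_
    linear_combination hder
  have hc : A 1 0 = 0 := by
    have hz0 := hz.self_of_nhds
    have d : HasDerivAt g (deriv g z) z := hz0.2.2.hasDerivAt
    have hder := (d.const_mul (2 * A 1 0)).unique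
      ((hasDerivAt_const z (A 0 0 - A 1 1)).congr_of_eventuallyEq hrel')
    have h0 : deriv g z ≠ 0 := hz0.2.1.2
    simpa [h0] using hder
  have had : A 0 0 = A 1 1 := by
    have := hrel'.self_of_nhds
    rw [hc] at this
    linear_combination -this
  have hb : A 0 1 = 0 := by
    have := hrel.self_of_nhds
    rw [hc, had] at this
    linear_combination -this
  have hdet := A.det_coe
  rw [Matrix.det_fin_two, hc, hb, had] at hdet
  have hsq : A 1 1 = 1 ∨ A 1 1 = -1 := mul_self_eq_one_iff.1 (by linear_combination hdet)
  refine hsq.imp (fun h => ?_) fun h => ?_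
  · ext i j
    fin_cases i <;> fin_cases j <;> simp [hb, hc, had, h]
  · ext i j
    fin_cases i <;> fin_cases j <;> simp [hb, hc, had, h]

end Words

/-! ### The monodromy representation and its image -/

theorem mainTheorem4 {M : Type*} [TopologicalSpace M] [T2Space M] [ConnectedSpace M]
    [ChartedSpace ℂ M] [IsManifold 𝓘(ℂ) ω M] (o : M) {N : ℕ}
    (μ : Fin N → C(M, M)) (hμ : ∀ j, IsReflection (μ j))
    (P : ∀ j, Path o (μ j o)) (hP : ∀ j, IsInvariantPath (μ j) (P j))
    (hgen : IsGenerator fun j => reflectionLift (μ j) (P j))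
    (G : M → OnePoint ℂ) (hG : IsMeromorphicFunction G) (Q : HolomorphicTwoDifferential M)
    (hadm : IsAdmissible G Q) (hinv : ∀ j, IsInvariantPair (μ j) G Q)
    (F : UniversalCover o → SL(2, ℂ)) (hF : IsSolution G Q F)
    (hSU : ∀ j ρ, IsReflectionMatrix G F (μ j) (P j) ρ → ρ ∈ SU11) :
    (∃! ρF : PiOne o →* SL(2, ℂ), IsAssociatedRepresentation F ρF) ∧
      ∀ ρF : PiOne o →* SL(2, ℂ), IsAssociatedRepresentation F ρF → ρF.range ≤ SU11 := by
  have hne : ¬ ∃ c, ∀ x, G x = c := by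
    obtain ⟨⟨φ, -, z, -, hreg⟩, -⟩ := hadm
    exact hreg.not_const
  have hS := hG.isSphereHolomorphic
  refine ⟨hF.solvesOn.existsUnique_representation (trace_psiCoeff G Q) fun φ hφ z hz =>
    ((hS.eventually_isRegularAt hne hφ hz).mono fun w hw => hw.2.1).frequently, ?_⟩
  rintro ρF hρF _ ⟨τ, rfl⟩
  choose ρ hρ using fun j => hF.exists_isReflectionMatrix hG (hμ j) hadm (hinv j) (P j)
  obtain ⟨l, hl, hτ⟩ := hgen τ
  obtain ⟨A, B, hB, hAB⟩ := (exists_mul_mul_of_word hρ (fun j => hSU j _ (hρ j)) l).1 hl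
  rw [← hτ] at hAB
  have : LocallyPathConnectedSpace M := ChartedSpace.locallyPathConnectedSpace ℂ M
  have : PathConnectedSpace M := pathConnectedSpace_iff_connectedSpace.2 inferInstance
  -- Every `x` is the projection of the class of a path from `o`, and `τ` preserves projections, so
  -- the relation for `G` becomes `G x = A ⋆ G x`.
  have hA := hS.eq_one_or_neg_one_of_smul_eq hne (A := A) fun x =>
    (hAB ⟨x, .mk (PathConnectedSpace.somePath o x)⟩).2
  have h := (hAB ⟨o, .mk (Path.refl o)⟩).1
  rw [hρF] at h
  have hinvmem : (ρF τ)⁻¹ ∈ SU11 := by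
    rcases hA with rfl | rfl
    · rw [one_mul, mul_right_inj] at h
      exact h ▸ hB
    · have h' : (ρF τ)⁻¹ = -1 * B := by
        refine mul_left_cancel (h.trans ?_)
        simp
      exact h' ▸ SU11.mul_mem neg_one_mem_SU11 hB
  simpa using SU11.inv_mem hinvmem

end
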